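/- Let $n\ge 1$, $m\ge 0$, write $\bar x=(x_1,\dots,x_n)$ and $\bar x_{n-1}=(x_1,\dots,x_{n-1})$ with $x_i\in\mathbb R^m$, and let $\|\cdot\|$ be the Euclidean norm of vectors and the spectral norm of matrices. Consider the system with actuator faults $$\dot x_i=x_{i+1}\ (1\le i\le n-1),\qquad \dot x_n=f(\bar x)+g(\bar x,t)u_a+d(\bar x,t),\qquad u_a=\rho(t)u+\varepsilon(t),$$ where $\rho(t)=\mathrm{diag}(\rho_1(t),\dots,\rho_m(t))$ with $\rho_j(t)\in(0,1]$ (no continuity in $t$ is required; in particular $\rho$ may be piecewise continuous) and $\|\varepsilon(t)\|<\bar\varepsilon<\infty$ for all $t\ge0$. Let $y^*:[0,\infty)\to\mathbb R^m$ be $n$ times differentiable, bounded together with its derivatives up to order $n$. Put $e=x_1-y^*$, $e_i=x_i-y^{*(i-1)}$ ($1\le i\le n$), $s=\lambda_1e_1+\dots+\lambda_{n-1}e_{n-1}+e_n$ and $\Phi=\lambda_1e_2+\dots+\lambda_{n-1}e_n$, where $z^{n-1}+\lambda_{n-1}z^{n-2}+\dots+\lambda_1$ is Hurwitz. Assume the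 following for all $\bar x$ and all $t\ge 0$. (a) There are a symmetric matrix function $\alpha(\bar x_{n-1},t)\in\mathbb R^{m\times m}$, differentiable in $(\bar x_{n-1},t)$, and constants $c>0$, $\underline\lambda,\bar\lambda$ with $\underline\lambda\bar\lambda>0$, such that $\alpha\ge cI$ and $\underline\lambda I\le \alpha g\rho+\rho g^T\alpha\le\bar\lambda I$. (b) There are constants $a_f^*,a_1,a_2>0$ and nonnegative functions $\varphi_f^*(\bar x),\varphi_1(\bar x_{n-1}),\varphi_2(\bar x)$, bounded on bounded sets, such that $$\|f+g\varepsilon+d\|\le a_f^*\varphi_f^*,\qquad \|\alpha\|\le a_1\varphi_1,\qquad \Big\|\frac{\partial\alpha}{\partial t}+\sum_{j=1}^{n-1}\frac{\partial\alpha}{\partial x_j}x_{j+1}\Big\|\le a_2\varphi_2 .$$ Apply the controller $$u=\hbar(\zeta)\eta,\quad \eta=ks+\frac{\hat\theta\varphi^2s}{\varphi\|s\|+\nu(t)},\quad \dot\zeta=\sigma_1s^T\eta,\quad \dot{\hat\theta}=\frac{\sigma_2\varphi^2\|s\|^2}{\varphi\|s\|+\nu(t)},\quad \zeta(0)\ge0,\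 \hat\theta(0)\ge0,$$ with $\varphi=\varphi_1(\|\Phi\|+\varphi_f^*+1)+\frac12\varphi_2\|s\|$, constants $k,\sigma_1,\sigma_2>0$, and a locally integrable $\nu\ge0$ with $\sup_{t\ge0}\int_0^t\nu<\infty$ (a quotient $0/0$ is read as $0$). Here $\hbar:[0,\infty)\to\mathbb R$ is a Nussbaum function of type $BL$ for some constant $L>\max\{\underline\lambda/\bar\lambda,\bar\lambda/\underline\lambda\}$, $L>1$; that is, $\hbar$ is continuously differentiable and, with $\hbar^\pm=\max\{0,\pm\hbar\}$ and $H^\pm(\zeta)=\int_0^\zeta\hbar^\pm$, $$\lim_{\zeta\to\infty}\frac{H^\pm(\zeta)}{\zeta}=\infty,\qquad \limsup_{\zeta\to\infty}\frac{H^+(\zeta)}{H^-(\zeta)}\ge L,\qquad \limsup_{\zeta\to\infty}\frac{H^-(\zeta)}{H^+(\zeta)}\ge L .$$ Solutions of the closed loop are understood in the sense of Carathéodory. Then: 1. All signals of the closed loop are globally uniformly bounded: for every $R$ there is a $B$ such that, for every solution on an interval $[0,T)$, $0<T\le\infty$, with $\|x_i(0)\|\le R$ ($1\le i\le n$), $\zeta(0)\le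 R$ and $\hat\theta(0)\le R$, each of $x_i,e_i$ ($1\le i\le n$), $s,\zeta,\hat\theta,\eta,u,u_a$ and the right-hand sides of the equations for $\dot\zeta$ and $\dot{\hat\theta}$ is bounded in norm by $B$ on all of $[0,T)$. 2. For every solution on $[0,\infty)$, $e(t)\to0$ as $t\to\infty$. -/

import Mathlib

open Set Filter Topology MeasureTheory
open scoped Matrix Matrix.Norms.L2Operator

noncomputable section

namespace FaultTolerant

/-- `ℝᵐ` with the Euclidean norm. -/
abbrev Vec (m : ℕ) : Type := EuclideanSpace ℝ (Fin m)

/-- Real `m × m` matrices; their norm is the spectral norm. -/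
abbrev Mat (m : ℕ) : Type := Matrix (Fin m) (Fin m) ℝ

/-- Matrix times vector, `A v`. -/
def act {m : ℕ} (A : Mat m) (v : Vec m) : Vec m := WithLp.toLp 2 (A *ᵥ v.ofLp)

/-- A Nussbaum function of type `BL` for the constant `L > 1`, on `[0, ∞)`. A function of type `B`
is one that is of type `BL` for every `L > 1`. The upper limits are taken in `[-∞, ∞]`. -/
structure IsNussbaumBL (L : ℝ) (h : ℝ → ℝ) : Prop where
  one_lt : 1 < L
  contDiff : ContDiffOn ℝ 1 h (Ici 0)
  pos_tendsto : Tendsto (fun z : ℝ => (∫ τ in (0 : ℝ)..z, max 0 (h τ)) / z) atTop atTop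
  pos_limsup : (L : EReal) ≤ limsup (fun z : ℝ =>
    (((∫ τ in (0 : ℝ)..z, max 0 (h τ)) / (∫ τ in (0 : ℝ)..z, max 0 (-h τ)) : ℝ) : EReal)) atTop
  neg_tendsto : Tendsto (fun z : ℝ => (∫ τ in (0 : ℝ)..z, max 0 (-h τ)) / z) atTop atTop
  neg_limsup : (L : EReal) ≤ limsup (fun z : ℝ =>
    (((∫ τ in (0 : ℝ)..z, max 0 (-h τ)) / (∫ τ in (0 : ℝ)..z, max 0 (h τ)) : ℝ) : EReal)) atTop

/-- The plant of order `n = r + 1` with its actuator faults: the drift `f`, the input gain `g`, the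
disturbance `d`, the effectiveness factors `ρ` and the additive fault `ε`.
The state is `x̄ = (x₁, …, xₙ)`, indexed by `Fin (r + 1)`. -/
structure Plant (r m : ℕ) where
  f : (Fin (r + 1) → Vec m) → Vec m
  g : (Fin (r + 1) → Vec m) → ℝ → Mat m
  d : (Fin (r + 1) → Vec m) → ℝ → Vec m
  ρ : ℝ → Fin m → ℝ
  ε : ℝ → Vec m

/-- The data available to the control algorithm: the desired trajectory `y`, the filter
coefficients `lam` (`λ₁, …, λₙ₋₁`), the gains, the Nussbaum function `h`, the function `ν`, and the
known bounding functions `φ₁`, `φ₂`, `φf`. -/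
structure Controller (r m : ℕ) where
  y : ℝ → Vec m
  lam : Fin r → ℝ
  k : ℝ
  σ₁ : ℝ
  σ₂ : ℝ
  h : ℝ → ℝ
  ν : ℝ → ℝ
  φ₁ : (Fin r → Vec m) → ℝ
  φ₂ : (Fin (r + 1) → Vec m) → ℝ
  φf : (Fin (r + 1) → Vec m) → ℝ

/-- `(x₁, …, xₙ₋₁)`. -/
def lower {r m : ℕ} (x : Fin (r + 1) → Vec m) : Fin r → Vec m := fun i => x i.castSucc

/-- `(x₂, …, xₙ)`. -/
def upper {r m : ℕ} (x : Fin (r + 1) → Vec m) : Fin r → Vec m := fun i => x i.succ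

namespace Controller

variable {r m : ℕ} (C : Controller r m)

/-- The errors `e₁ = x₁ - y, …, eₙ = xₙ - y⁽ⁿ⁻¹⁾` at the state `x` and the time `t`. -/
def err (x : Fin (r + 1) → Vec m) (t : ℝ) (i : Fin (r + 1)) : Vec m :=
  x i - iteratedDerivWithin (i : ℕ) C.y (Ici 0) t

/-- The filtered error `s = λ₁ e₁ + ⋯ + λₙ₋₁ eₙ₋₁ + eₙ`. -/
def filt (x : Fin (r + 1) → Vec m) (t : ℝ) : Vec m :=
  (∑ i : Fin r, C.lam i • C.err x t i.castSucc) + C.err x t (Fin.last r)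

/-- `Φ = λ₁ e₂ + ⋯ + λₙ₋₁ eₙ`. -/
def Phi (x : Fin (r + 1) → Vec m) (t : ℝ) : Vec m :=
  ∑ i : Fin r, C.lam i • C.err x t i.succ

/-- The core function `φ = φ₁ (‖Φ‖ + φf + 1) + φ₂ ‖s‖ / 2`. -/
def core (x : Fin (r + 1) → Vec m) (t : ℝ) : ℝ :=
  C.φ₁ (lower x) * (‖C.Phi x t‖ + C.φf x + 1) + 1 / 2 * C.φ₂ x * ‖C.filt x t‖

/-- `η = k s + θ̂ φ² s / (φ ‖s‖ + ν)`; the quotient is `0` where it reads `0 / 0`. -/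
def eta (x : Fin (r + 1) → Vec m) (θ t : ℝ) : Vec m :=
  C.k • C.filt x t +
    (θ * C.core x t ^ 2 / (C.core x t * ‖C.filt x t‖ + C.ν t)) • C.filt x t

/-- The designed control signal `u = ħ(ζ) η`. -/
def control (x : Fin (r + 1) → Vec m) (ζ θ t : ℝ) : Vec m := C.h ζ • C.eta x θ t

/-- The right-hand side of the law for `ζ`. -/
def ζRate (x : Fin (r + 1) → Vec m) (θ t : ℝ) : ℝ :=
  C.σ₁ * inner ℝ (C.filt x t) (C.eta x θ t)

/-- The right-hand side of the law for `θ̂`. -/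
def θRate (x : Fin (r + 1) → Vec m) (t : ℝ) : ℝ :=
  C.σ₂ * C.core x t ^ 2 * ‖C.filt x t‖ ^ 2 / (C.core x t * ‖C.filt x t‖ + C.ν t)

/-- The desired trajectory is `n` times differentiable on `[0, ∞)`, and it and its derivatives up
to the order `n` are bounded there. -/
structure GoodReference : Prop where
  differentiable : ∀ i : ℕ, i ≤ r →
    DifferentiableOn ℝ (iteratedDerivWithin i C.y (Ici 0)) (Ici 0)
  bounded : ∀ i : ℕ, i ≤ r + 1 →
    ∃ K : ℝ, ∀ t : ℝ, 0 ≤ t → ‖iteratedDerivWithin i C.y (Ici 0) t‖ ≤ K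

/-- The requirements on the design parameters, apart from those on the Nussbaum function: positive
gains, a Hurwitz polynomial `zⁿ⁻¹ + λₙ₋₁ zⁿ⁻² + ⋯ + λ₁`, and a nonnegative `ν` with bounded
integrals. -/
structure GoodDesign : Prop where
  k_pos : 0 < C.k
  σ₁_pos : 0 < C.σ₁
  σ₂_pos : 0 < C.σ₂
  hurwitz : ∀ z : ℂ, z ^ r + ∑ i : Fin r, (C.lam i : ℂ) * z ^ (i : ℕ) = 0 → z.re < 0
  ν_nonneg : ∀ t : ℝ, 0 ≤ t → 0 ≤ C.ν t
  ν_integrable : ∀ t : ℝ, 0 ≤ t → IntervalIntegrable C.ν volume 0 t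
  ν_bounded : ∃ K : ℝ, ∀ t : ℝ, 0 ≤ t → ∫ τ in (0 : ℝ)..t, C.ν τ ≤ K

/-- The known bounding functions are nonnegative and bounded on bounded sets. -/
structure GoodBounds : Prop where
  φ₁_nonneg : ∀ x, 0 ≤ C.φ₁ x
  φ₂_nonneg : ∀ x, 0 ≤ C.φ₂ x
  φf_nonneg : ∀ x, 0 ≤ C.φf x
  φ₁_bounded : ∀ R : ℝ, ∃ K : ℝ, ∀ x, ‖x‖ ≤ R → C.φ₁ x ≤ K
  φ₂_bounded : ∀ R : ℝ, ∃ K : ℝ, ∀ x, ‖x‖ ≤ R → C.φ₂ x ≤ K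
  φf_bounded : ∀ R : ℝ, ∃ K : ℝ, ∀ x, ‖x‖ ≤ R → C.φf x ≤ K

end Controller

namespace Plant

variable {r m : ℕ} (P : Plant r m)

/-- The actual actuator output `u_a = ρ(t) u + ε(t)`. -/
def actuator (t : ℝ) (u : Vec m) : Vec m := act (Matrix.diagonal (P.ρ t)) u + P.ε t

/-- Partial loss of effectiveness, `ρⱼ(t) ∈ (0, 1]`, and a bounded additive fault. No regularity
in `t` is asked for, so `ρ` may be piecewise continuous. -/
structure Faults : Prop where
  ρ_mem : ∀ t : ℝ, 0 ≤ t → ∀ j, P.ρ t j ∈ Ioc (0 : ℝ) 1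
  ε_bounded : ∃ K : ℝ, ∀ t : ℝ, 0 ≤ t → ‖P.ε t‖ < K

/-- `α g ρ + ρ gᵀ α`. -/
def symGain (α : (Fin r → Vec m) → ℝ → Mat m) (x : Fin (r + 1) → Vec m) (t : ℝ) : Mat m :=
  α (lower x) t * P.g x t * Matrix.diagonal (P.ρ t) +
    Matrix.diagonal (P.ρ t) * (P.g x t)ᵀ * α (lower x) t

/-- The controllability condition: `α(x₁, …, xₙ₋₁, t)` is symmetric, uniformly positive definite
(`α ≥ c I` with `c > 0`), differentiable in all its arguments together, and
`lo I ≤ α g ρ + ρ gᵀ α ≤ hi I` with constants `lo`, `hi` of the same strict sign. -/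
structure Controllable (α : (Fin r → Vec m) → ℝ → Mat m) (c lo hi : ℝ) : Prop where
  c_pos : 0 < c
  same_sign : 0 < lo * hi
  symm : ∀ x, ∀ t : ℝ, 0 ≤ t → (α x t).IsSymm
  posDef : ∀ x, ∀ t : ℝ, 0 ≤ t → (α x t - c • (1 : Mat m)).PosSemidef
  differentiable : DifferentiableOn ℝ (fun p : (Fin r → Vec m) × ℝ => α p.1 p.2) (univ ×ˢ Ici 0)
  gain_lower : ∀ x, ∀ t : ℝ, 0 ≤ t → (P.symGain α x t - lo • (1 : Mat m)).PosSemidef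
  gain_upper : ∀ x, ∀ t : ℝ, 0 ≤ t → (hi • (1 : Mat m) - P.symGain α x t).PosSemidef

/-- The growth conditions, with constants `af`, `a₁`, `a₂` that the controller does not know. The
last one bounds the time derivative of `α` along the motion,
`α̇ = ∂α/∂t + ∑ⱼ (∂α/∂xⱼ) xⱼ₊₁` (`1 ≤ j ≤ n - 1`). -/
structure Growth (C : Controller r m) (α : (Fin r → Vec m) → ℝ → Mat m) (af a₁ a₂ : ℝ) :
    Prop where
  af_pos : 0 < af
  a₁_pos : 0 < a₁
  a₂_pos : 0 < a₂
  drift : ∀ x, ∀ t : ℝ, 0 ≤ t → ‖P.f x + act (P.g x t) (P.ε t) + P.d x t‖ ≤ af * C.φf x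
  size : ∀ x, ∀ t : ℝ, 0 ≤ t → ‖α x t‖ ≤ a₁ * C.φ₁ x
  rate : ∀ x, ∀ t : ℝ, 0 ≤ t →
    ‖fderivWithin ℝ (fun p : (Fin r → Vec m) × ℝ => α p.1 p.2) (univ ×ˢ Ici 0)
      (lower x, t) (upper x, 1)‖ ≤ a₂ * C.φ₂ x

end Plant

/-- The time interval `[0, T)`, where `T` may be infinite. -/
def horizon (T : EReal) : Set ℝ := {t : ℝ | 0 ≤ t ∧ (t : EReal) < T}

/-- `(x, ζ, θ̂)` solves the closed loop of the faulty plant and the control algorithm on `[0, T)`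
in the sense of Carathéodory: all components are locally absolutely continuous, and the
differential equations hold at almost every time. The initial values of `ζ` and `θ̂` are
nonnegative. -/
structure IsClosedLoop {r m : ℕ} (P : Plant r m) (C : Controller r m) (T : EReal)
    (x : ℝ → Fin (r + 1) → Vec m) (ζ θ : ℝ → ℝ) : Prop where
  T_pos : 0 < T
  x_ac : ∀ b ∈ horizon T, ∀ i, AbsolutelyContinuousOnInterval (fun t => x t i) 0 b
  ζ_ac : ∀ b ∈ horizon T, AbsolutelyContinuousOnInterval ζ 0 b
  θ_ac : ∀ b ∈ horizon T, AbsolutelyContinuousOnInterval θ 0 b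
  x_chain : ∀ i : Fin r, ∀ᵐ t : ℝ, t ∈ horizon T →
    HasDerivAt (fun τ => x τ i.castSucc) (x t i.succ) t
  x_last : ∀ᵐ t : ℝ, t ∈ horizon T →
    HasDerivAt (fun τ => x τ (Fin.last r))
      (P.f (x t) + act (P.g (x t) t) (P.actuator t (C.control (x t) (ζ t) (θ t) t))
        + P.d (x t) t) t
  ζ_law : ∀ᵐ t : ℝ, t ∈ horizon T → HasDerivAt ζ (C.ζRate (x t) (θ t) t) t
  θ_law : ∀ᵐ t : ℝ, t ∈ horizon T → HasDerivAt θ (C.θRate (x t) t) t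
  ζ_init : 0 ≤ ζ 0
  θ_init : 0 ≤ θ 0

/-- At the time `t` every signal of the closed loop is at most `B` in norm: the states, the errors,
the filtered error, `ζ`, `θ̂`, `η`, the control signal, the actuator output, and the right-hand
sides of the two adaptive laws. -/
def SignalsBoundedBy {r m : ℕ} (P : Plant r m) (C : Controller r m)
    (x : ℝ → Fin (r + 1) → Vec m) (ζ θ : ℝ → ℝ) (B t : ℝ) : Prop :=
  (∀ i, ‖x t i‖ ≤ B) ∧ (∀ i, ‖C.err (x t) t i‖ ≤ B) ∧ ‖C.filt (x t) t‖ ≤ B ∧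
    |ζ t| ≤ B ∧ |θ t| ≤ B ∧ ‖C.eta (x t) (θ t) t‖ ≤ B ∧
    ‖C.control (x t) (ζ t) (θ t) t‖ ≤ B ∧
    ‖P.actuator t (C.control (x t) (ζ t) (θ t) t)‖ ≤ B ∧
    |C.ζRate (x t) (θ t) t| ≤ B ∧ |C.θRate (x t) t| ≤ B

/-- Uniform boundedness of all the signals, for initial data of any size: the bound depends on the
size `R` of the initial data, and neither on the solution nor on the time. -/
def SignalsGloballyUniformlyBounded {r m : ℕ} (P : Plant r m) (C : Controller r m) : Prop :=
  ∀ R : ℝ, ∃ B : ℝ, ∀ (T : EReal) (x : ℝ → Fin (r + 1) → Vec m) (ζ θ : ℝ → ℝ),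
    IsClosedLoop P C T x ζ θ → (∀ i, ‖x 0 i‖ ≤ R) → ζ 0 ≤ R → θ 0 ≤ R →
      ∀ t ∈ horizon T, SignalsBoundedBy P C x ζ θ B t

end FaultTolerant

end

/-! The proof is a Lyapunov estimate closed by the Nussbaum function. Let a dominate the unknown
constants, w = φ‖s‖ and G(z) = z + (hi H⁺(z) - lo H⁻(z)) / 2. The energy sᵀαs / 2 grows at a rate of
at most a w + (hi ħ⁺ - lo ħ⁻) / 2 · ζ' / σ₁: only the symmetric part of α g ρ enters, and hi or lo
bounds it according to the sign of ħ. Since w ≤ w² / (w + ν) + ν and ζ' / σ₁ = k‖s‖² + θ̂ w² / (w +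
ν), adding (θ̂ - a)² / (2σ₂) eliminates the unknown term and leaves V' + k‖s‖² ≤ aν + G(ζ)' / σ₁
(`lyapunov_le`).

After integration V + k∫‖s‖² ≤ D + G(ζ) / σ₁, where D depends only on the size of the initial data.
The condition on L makes G arbitrarily negative at arbitrarily large arguments
(`IsNussbaumBL.exists_lt`), so some Z beyond ζ(0) has G(Z) < -σ₁ D. The left side is nonnegative,
hence the continuous ζ never reaches Z. This bounds ζ, s, θ̂ and ∫‖s‖² uniformly; the Hurwitz
filter, inverted one root at a time (`exists_bound_of_hurwitz_roots`), carries the bound to errors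
and states, and the other signals follow.

For convergence, the energy has a bounded integral and a rate bounded above, so it vanishes at
infinity (`tendsto_zero_of_integral_bounded`); thus s → 0, and the filter gives e → 0.

The equations hold only almost everywhere, and α is merely differentiable, so its absolute
continuity along a solution is not automatic. But x₁, …, xₙ₋₁ have continuous rates and satisfy
their equations at every time; hence α along the motion is differentiable everywhere with a bounded
derivative, that is, Lipschitz on compact intervals. -/

namespace FaultTolerant

/-! ### Absolutely continuous functions and almost everywhere derivatives -/

section AbsoluteContinuity

variable {a b : ℝ}

/-- A function whose increments are dominated by those of two absolutely continuous functions is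
absolutely continuous. -/
theorem absolutelyContinuous_of_dist_le {X Y Z : Type*} [PseudoMetricSpace X]
    [PseudoMetricSpace Y] [PseudoMetricSpace Z] {f : ℝ → X} {g : ℝ → Y} {h : ℝ → Z} {C D : ℝ}
    (hg : AbsolutelyContinuousOnInterval g a b) (hh : AbsolutelyContinuousOnInterval h a b)
    (hf : ∀ u ∈ uIcc a b, ∀ v ∈ uIcc a b,
      dist (f u) (f v) ≤ C * dist (g u) (g v) + D * dist (h u) (h v)) :
    AbsolutelyContinuousOnInterval f a b := by
  unfold AbsolutelyContinuousOnInterval at hg hh ⊢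
  apply squeeze_zero' ?_ ?_ (by simpa using (hg.const_mul C).add (hh.const_mul D))
  · exact Filter.Eventually.of_forall <| fun _ ↦ Finset.sum_nonneg (fun i hi ↦ dist_nonneg)
  rw [eventually_inf_principal]
  filter_upwards with (n, I) hnI
  simp only [Finset.mul_sum, ← Finset.sum_add_distrib]
  simp only [AbsolutelyContinuousOnInterval.disjWithin, mem_ofPred_eq] at hnI
  gcongr with i hi
  exact hf _ (hnI.left i hi |>.left) _ (hnI.left i hi |>.right)

theorem absolutelyContinuous_bilin {E F G : Type*} [NormedAddCommGroup E] [NormedSpace ℝ E]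
    [NormedAddCommGroup F] [NormedSpace ℝ F] [NormedAddCommGroup G] [NormedSpace ℝ G]
    (B : E →L[ℝ] F →L[ℝ] G) {f : ℝ → E} {g : ℝ → F}
    (hf : AbsolutelyContinuousOnInterval f a b) (hg : AbsolutelyContinuousOnInterval g a b) :
    AbsolutelyContinuousOnInterval (fun t => B (f t) (g t)) a b := by
  obtain ⟨K, hK⟩ := hf.exists_bound
  obtain ⟨M, hM⟩ := hg.exists_bound
  refine absolutelyContinuous_of_dist_le (C := ‖B‖ * M) (D := ‖B‖ * K) hf hg
    fun u hu v hv => ?_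
  rw [dist_eq_norm, dist_eq_norm, dist_eq_norm]
  have h1 : B (f u) (g u) - B (f v) (g v) = B (f u - f v) (g u) + B (f v) (g u - g v) := by
    simp
  rw [h1]
  have h2 := B.le_opNorm₂ (f u - f v) (g u)
  have h3 := B.le_opNorm₂ (f v) (g u - g v)
  have h4 : ‖B‖ * ‖f u - f v‖ * ‖g u‖ ≤ ‖B‖ * ‖f u - f v‖ * M := by
    gcongr
    exact hM u hu
  have h5 : ‖B‖ * ‖f v‖ * ‖g u - g v‖ ≤ ‖B‖ * K * ‖g u - g v‖ := by
    gcongr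
    exact hK v hv
  calc _ ≤ _ := norm_add_le _ _
    _ ≤ _ := by nlinarith

theorem absolutelyContinuous_comp_lipschitzOn {X Y : Type*} [PseudoMetricSpace X]
    [PseudoMetricSpace Y] {F : X → Y} {g : ℝ → X} {K : NNReal} {s : Set X}
    (hF : LipschitzOnWith K F s) (hg : AbsolutelyContinuousOnInterval g a b)
    (hs : ∀ u ∈ uIcc a b, g u ∈ s) :
    AbsolutelyContinuousOnInterval (fun t => F (g t)) a b := by
  refine absolutelyContinuous_of_dist_le (C := K) (D := 0) hg hg fun u hu v hv => ?_
  simpa using hF.dist_le_mul _ (hs u hu) _ (hs v hv)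

theorem absolutelyContinuous_sum {ι F : Type*} [NormedAddCommGroup F] (s : Finset ι)
    {f : ι → ℝ → F} (hf : ∀ i ∈ s, AbsolutelyContinuousOnInterval (f i) a b) :
    AbsolutelyContinuousOnInterval (fun t => ∑ i ∈ s, f i t) a b := by
  classical
  induction s using Finset.induction_on with
  | empty =>
    simp only [Finset.sum_empty]
    exact ((LipschitzWith.const (0 : F)).lipschitzOnWith).absolutelyContinuousOnInterval
  | insert i s hi ih =>
    simp only [Finset.sum_insert hi]
    exact (hf i (Finset.mem_insert_self i s)).fun_add
      (ih fun j hj => hf j (Finset.mem_insert_of_mem hj))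

theorem absolutelyContinuous_of_norm_derivWithin_le {F : Type*} [NormedAddCommGroup F]
    [NormedSpace ℝ F] {f f' : ℝ → F} {K : ℝ} (hab : a ≤ b)
    (hf : ∀ t ∈ Icc a b, HasDerivWithinAt f (f' t) (Icc a b) t)
    (hK : ∀ t ∈ Icc a b, ‖f' t‖ ≤ K) : AbsolutelyContinuousOnInterval f a b := by
  refine LipschitzOnWith.absolutelyContinuousOnInterval (K := K.toNNReal) ?_
  rw [uIcc_of_le hab]
  refine (convex_Icc a b).lipschitzOnWith_of_nnnorm_hasDerivWithin_le hf fun t ht => ?_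
  rw [← NNReal.coe_le_coe, Real.coe_toNNReal', coe_nnnorm]
  exact (hK t ht).trans (le_max_left _ _)

/-- An absolutely continuous function with a nonpositive derivative almost everywhere decreases. -/
theorem le_of_ae_hasDerivAt_nonpos {f : ℝ → ℝ} (hab : a ≤ b)
    (hf : AbsolutelyContinuousOnInterval f a b)
    (hd : ∀ᵐ t : ℝ, t ∈ Ioo a b → ∃ d ≤ 0, HasDerivAt f d t) : f b ≤ f a := by
  have h1 := hf.integral_deriv_eq_sub
  have h2 : ∫ x in a..b, deriv f x ≤ 0 := by
    rw [intervalIntegral.integral_of_le hab, integral_Ioc_eq_integral_Ioo]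
    refine integral_nonpos_of_ae ?_
    rw [EventuallyLE, ae_restrict_iff' measurableSet_Ioo]
    filter_upwards [hd] with t ht hmem
    obtain ⟨d, hd0, hd⟩ := ht hmem
    rw [hd.deriv]
    exact hd0
  linarith

theorem antitoneOn_of_ae_hasDerivAt_nonpos {f : ℝ → ℝ}
    (hf : AbsolutelyContinuousOnInterval f a b)
    (hd : ∀ᵐ t : ℝ, t ∈ Ioo a b → ∃ d ≤ 0, HasDerivAt f d t) : AntitoneOn f (Icc a b) := by
  intro u hu v hv huv
  have hab : a ≤ b := hu.1.trans hu.2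
  refine le_of_ae_hasDerivAt_nonpos huv (hf.mono ?_) ?_
  · rw [uIcc_of_le huv, uIcc_of_le hab]
    exact Icc_subset_Icc hu.1 hv.2
  · filter_upwards [hd] with t ht hmem
    exact ht ⟨hu.1.trans_lt hmem.1, hmem.2.trans_le hv.2⟩

/-- If the almost everywhere derivative of an absolutely continuous function agrees with a
continuous function, then it is the derivative everywhere. -/
theorem hasDerivWithinAt_of_ae_hasDerivAt {F : Type*} [NormedAddCommGroup F] [NormedSpace ℝ F]
    [CompleteSpace F] {f g : ℝ → F} (hab : a ≤ b) (hf : AbsolutelyContinuousOnInterval f a b)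
    (hg : ContinuousOn g (Icc a b))
    (hd : ∀ᵐ t : ℝ, t ∈ Icc a b → HasDerivAt f (g t) t) :
    ∀ t ∈ Icc a b, HasDerivWithinAt f (g t) (Icc a b) t := by
  -- Extending g by constants gives a primitive differentiable on all of ℝ. The difference of f and
  -- this primitive has zero derivative almost everywhere, so absolute continuity makes it constant.
  set G : ℝ → F := fun τ => g (projIcc a b hab τ) with hG
  have hGc : Continuous G := by
    rw [continuousOn_iff_continuous_domRestrict] at hg
    exact hg.comp continuous_projIcc
  have hGeq : ∀ t ∈ Icc a b, G t = g t := fun t ht => by simp [hG, projIcc_of_mem hab ht]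
  have hI : ∀ t, HasDerivAt (fun τ => ∫ s in a..τ, G s) (G t) t := fun t =>
    intervalIntegral.integral_hasDerivAt_right (hGc.intervalIntegrable _ _)
      (hGc.stronglyMeasurableAtFilter _ _) hGc.continuousAt
  obtain ⟨K, hK⟩ := isCompact_Icc.exists_bound_of_continuousOn hGc.continuousOn (s := Icc a b)
  have hIac : AbsolutelyContinuousOnInterval (fun τ => ∫ s in a..τ, G s) a b :=
    absolutelyContinuous_of_norm_derivWithin_le hab (fun t _ => (hI t).hasDerivWithinAt) hK
  obtain ⟨c, hc⟩ := (hf.fun_sub hIac).const_of_ae_hasDerivAt_zero (by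
    rw [uIcc_of_le hab]
    filter_upwards [hd] with t ht hmem
    have := (ht hmem).sub (hI t)
    rw [hGeq t hmem, sub_self] at this
    exact this)
  rw [uIcc_of_le hab] at hc
  intro t ht
  have h1 : HasDerivWithinAt (fun τ => c + ∫ s in a..τ, G s) (g t) (Icc a b) t := by
    rw [← hGeq t ht]
    exact ((hI t).const_add c).hasDerivWithinAt
  refine h1.congr (fun τ hτ => ?_) ?_
  · rw [← hc τ hτ]; simp
  · rw [← hc t ht]; simp

end AbsoluteContinuity

/-! ### Stable scalar equations and Hurwitz polynomials -/

section StableFilter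

/-- The estimate for the scalar equation `w' = z w + v` with `Re z < 0`. -/
theorem norm_le_of_stable {z : ℂ} (hz : z.re < 0) {a b M : ℝ} (hM : 0 ≤ M) {w v : ℝ → ℂ}
    (hc : ContinuousOn w (Icc a b))
    (hw : ∀ t ∈ Ico a b, HasDerivWithinAt w (z * w t + v t) (Ici t) t)
    (hv : ∀ t ∈ Ico a b, ‖v t‖ ≤ M) :
    ∀ t ∈ Icc a b, ‖w t‖ ≤ Real.exp (z.re * (t - a)) * ‖w a‖ + M / (-z.re) := by
  have hμ : 0 < -z.re := by linarith
  have hexp : ∀ t : ℝ, HasDerivAt (fun τ : ℝ => Complex.exp (-z * ((τ - a : ℝ) : ℂ)))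
      (Complex.exp (-z * ((t - a : ℝ) : ℂ)) * (-z)) t := by
    intro t
    have h1 : HasDerivAt (fun τ : ℝ => ((τ - a : ℝ) : ℂ)) 1 t := by
      simpa using ((hasDerivAt_id t).sub_const a).ofReal_comp
    simpa using (h1.const_mul (-z)).cexp
  have hnorm : ∀ t : ℝ, ‖Complex.exp (-z * ((t - a : ℝ) : ℂ))‖ = Real.exp (-z.re * (t - a)) := by
    intro t
    rw [Complex.norm_exp]
    congr 1
    simp
  have hB : ∀ t : ℝ, HasDerivAt
      (fun τ : ℝ => ‖w a‖ + M / (-z.re) * (Real.exp (-z.re * (τ - a)) - 1))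
      (M * Real.exp (-z.re * (t - a))) t := by
    intro t
    have h1 : HasDerivAt (fun τ : ℝ => -z.re * (τ - a)) (-z.re) t := by
      simpa using ((hasDerivAt_id t).sub_const a).const_mul (-z.re)
    have h2 := ((h1.exp.sub_const 1).const_mul (M / (-z.re))).const_add ‖w a‖
    refine h2.congr_deriv ?_
    rw [mul_comm (Real.exp _), ← mul_assoc, div_mul_cancel₀ _ hμ.ne']
  -- The integrating factor exp(-z(t - a)) removes z w; what remains of the derivative is bounded by
  -- the derivative of the comparison function `hB`.
  have key := image_norm_le_of_norm_deriv_right_le_deriv_boundary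
    (f := fun t => Complex.exp (-z * ((t - a : ℝ) : ℂ)) * w t)
    (f' := fun t => Complex.exp (-z * ((t - a : ℝ) : ℂ)) * v t)
    (a := a) (b := b)
    (ContinuousOn.mul (fun t _ => (hexp t).continuousAt.continuousWithinAt) hc)
    (fun t ht => by
      have := (hexp t).hasDerivWithinAt.mul (hw t ht)
      refine this.congr_deriv ?_
      ring)
    (by simp) hB
    (fun t ht => by
      rw [norm_mul, hnorm, mul_comm]
      gcongr
      exact hv t ht)
  intro t ht
  have h1 := key ht
  rw [norm_mul, hnorm] at h1
  have h2 : Real.exp (z.re * (t - a)) * Real.exp (-z.re * (t - a)) = 1 := by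
    rw [← Real.exp_add]; simp
  have h3 : 0 < Real.exp (z.re * (t - a)) := Real.exp_pos _
  have h4 : 0 ≤ M / (-z.re) := by positivity
  calc ‖w t‖ = Real.exp (z.re * (t - a)) * (Real.exp (-z.re * (t - a)) * ‖w t‖) := by
        rw [← mul_assoc, h2, one_mul]
    _ ≤ Real.exp (z.re * (t - a)) *
        (‖w a‖ + M / (-z.re) * (Real.exp (-z.re * (t - a)) - 1)) := by gcongr
    _ = Real.exp (z.re * (t - a)) * ‖w a‖ +
        M / (-z.re) * (Real.exp (z.re * (t - a)) * Real.exp (-z.re * (t - a))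
          - Real.exp (z.re * (t - a))) := by ring
    _ ≤ _ := by rw [h2]; nlinarith

/-- The estimate is restarted at a time after which v stays small: the value at the restart decays
exponentially, and v contributes at most its bound divided by -Re z. -/
theorem tendsto_zero_of_stable {z : ℂ} (hz : z.re < 0) {w v : ℝ → ℂ}
    (hc : ContinuousOn w (Ici 0))
    (hw : ∀ t : ℝ, 0 ≤ t → HasDerivWithinAt w (z * w t + v t) (Ici t) t)
    (hv : Tendsto v atTop (𝓝 0)) : Tendsto w atTop (𝓝 0) := by
  have hμ : 0 < -z.re := by linarith
  rw [Metric.tendsto_atTop] at hv ⊢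
  intro ε hε
  obtain ⟨N, hN⟩ := hv (ε / 2 * (-z.re)) (by positivity)
  set a := max N 0
  have hexp : Tendsto (fun t : ℝ => Real.exp (z.re * (t - a)) * ‖w a‖) atTop (𝓝 0) := by
    have h1 : Tendsto (fun t : ℝ => z.re * (t - a)) atTop atBot :=
      (tendsto_atTop_add_const_right atTop (-a) tendsto_id).const_mul_atTop_of_neg hz
    simpa using (Real.tendsto_exp_atBot.comp h1).mul_const ‖w a‖
  rw [Metric.tendsto_atTop] at hexp
  obtain ⟨N', hN'⟩ := hexp (ε / 2) (by positivity)
  refine ⟨max N' a, fun t ht => ?_⟩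
  have hta : a ≤ t := (le_max_right _ _).trans ht
  have h0a : 0 ≤ a := le_max_right _ _
  have h1 := norm_le_of_stable hz (a := a) (b := t) (M := ε / 2 * (-z.re)) (by positivity)
    (hc.mono fun τ hτ => h0a.trans hτ.1) (fun τ hτ => hw τ (h0a.trans hτ.1))
    (fun τ hτ => by
      have := hN τ ((le_max_left _ _).trans hτ.1)
      rw [dist_zero_right] at this
      exact this.le) t ⟨hta, le_rfl⟩
  have h2 := hN' t ((le_max_left _ _).trans ht)
  rw [dist_zero_right, Real.norm_eq_abs] at h2
  rw [dist_zero_right]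
  have h3 : ε / 2 * (-z.re) / (-z.re) = ε / 2 := mul_div_cancel_right₀ _ hμ.ne'
  rw [h3] at h1
  linarith [le_abs_self (Real.exp (z.re * (t - a)) * ‖w a‖)]

open Polynomial in
/-- Applying `(D - z) q(D)` to a chain `E` is applying `q(D)` to the chain `E' - z E`. -/
theorem sum_coeff_X_sub_C_mul (z : ℂ) {q : ℂ[X]} {n : ℕ} (hq : q.natDegree = n) (E : ℕ → ℂ) :
    ∑ i ∈ Finset.range (n + 2), ((X - C z) * q).coeff i * E i =
      ∑ i ∈ Finset.range (n + 1), q.coeff i * (E (i + 1) - z * E i) := by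
  have h0 : q.coeff (n + 1) = 0 := coeff_eq_zero_of_natDegree_lt (by omega)
  have h1 : ∑ i ∈ Finset.range (n + 2), (X * q).coeff i * E i =
      ∑ i ∈ Finset.range (n + 1), q.coeff i * E (i + 1) := by
    rw [Finset.sum_range_succ']
    simp
  have h2 : ∑ i ∈ Finset.range (n + 2), q.coeff i * E i =
      ∑ i ∈ Finset.range (n + 1), q.coeff i * E i := by
    rw [Finset.sum_range_succ, h0]; simp
  simp only [sub_mul, coeff_sub, coeff_C_mul, mul_sub, Finset.sum_sub_distrib]
  rw [h1]
  congr 1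
  simp only [mul_left_comm _ z, mul_assoc, ← Finset.mul_sum]
  rw [h2]

-- Induction on the roots. Splitting off z, the chain E' - z E is driven by the same input through
-- the remaining roots; then E 0 solves a stable scalar equation with bounded input, and E (i + 1) =
-- (E (i + 1) - z E i) + z E i recovers the rest.
open Polynomial in
theorem exists_bound_of_hurwitz_roots (S : Multiset ℂ) (hS : ∀ z ∈ S, z.re < 0) :
    ∃ K : ℝ, 0 ≤ K ∧ ∀ (b M : ℝ) (E : ℕ → ℝ → ℂ), 0 ≤ b → 0 ≤ M →
      (∀ i < S.card, ContinuousOn (E i) (Icc 0 b)) →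
      (∀ i < S.card, ∀ t ∈ Ico 0 b, HasDerivWithinAt (E i) (E (i + 1) t) (Ici t) t) →
      (∀ i ≤ S.card, ‖E i 0‖ ≤ M) →
      (∀ t ∈ Icc 0 b, ‖∑ i ∈ Finset.range (S.card + 1),
        ((S.map fun z => X - C z).prod).coeff i * E i t‖ ≤ M) →
      (∀ i ≤ S.card, ∀ t ∈ Icc 0 b, ‖E i t‖ ≤ K * M) := by
  induction S using Multiset.induction_on with
  | empty =>
    refine ⟨1, zero_le_one, fun b M E _ _ _ _ _ h i hi t ht => ?_⟩
    obtain rfl : i = 0 := by simpa using hi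
    simpa using h t ht
  | cons z S ih =>
    obtain ⟨K, hK, ih⟩ := ih fun w hw => hS w (Multiset.mem_cons_of_mem hw)
    have hz := hS z (Multiset.mem_cons_self z S)
    have hμ : 0 < -z.re := by linarith
    set n := S.card with hn
    -- The outer summands come from the scalar estimate of E 0. The middle one lets A M dominate the
    -- bound of the reduced chain, so that each further index costs only a factor 1 + ‖z‖.
    set A : ℝ := 1 + K * (1 + ‖z‖) + K * (1 + ‖z‖) / (-z.re) with hA
    have hA0 : 0 ≤ A := by positivity
    refine ⟨A * (1 + ‖z‖) ^ (n + 1), by positivity, fun b M E hb hM hc hd h0 hsum => ?_⟩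
    rw [Multiset.card_cons] at hc hd h0 hsum ⊢
    rw [Multiset.map_cons, Multiset.prod_cons] at hsum
    have hF : ∀ i ≤ n, ∀ t ∈ Icc 0 b, ‖E (i + 1) t - z * E i t‖ ≤ K * ((1 + ‖z‖) * M) := by
      refine ih b ((1 + ‖z‖) * M) (fun i t => E (i + 1) t - z * E i t) hb (by positivity)
        ?_ ?_ ?_ ?_
      · intro i hi
        exact (hc (i + 1) (by omega)).sub (continuousOn_const.mul (hc i (by omega)))
      · intro i hi t ht
        exact (hd (i + 1) (by omega) t ht).sub ((hd i (by omega) t ht).const_mul z)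
      · intro i hi
        calc _ ≤ ‖E (i + 1) 0‖ + ‖z * E i 0‖ := norm_sub_le _ _
          _ ≤ M + ‖z‖ * M := by
            rw [norm_mul]
            gcongr
            · exact h0 _ (by omega)
            · exact h0 _ (by omega)
          _ = _ := by ring
      · intro t ht
        have h1 := hsum t ht
        rw [sum_coeff_X_sub_C_mul z (natDegree_multiset_prod_X_sub_C_eq_card S)
          (fun i => E i t)] at h1
        exact h1.trans (by nlinarith [norm_nonneg z])
    have hE0 : ∀ t ∈ Icc 0 b, ‖E 0 t‖ ≤ A * M := by
      intro t ht
      have h1 := norm_le_of_stable hz (a := 0) (b := b) (M := K * ((1 + ‖z‖) * M))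
        (by positivity) (hc 0 (by omega)) (v := fun t => E (0 + 1) t - z * E 0 t)
        (fun t ht => by simpa using hd 0 (by omega) t ht)
        (fun t ht => hF 0 (by omega) t ⟨ht.1, ht.2.le⟩) t ht
      have h2 : Real.exp (z.re * (t - 0)) ≤ 1 := Real.exp_le_one_iff.2 (by nlinarith [ht.1])
      have h3 : Real.exp (z.re * (t - 0)) * ‖E 0 0‖ ≤ 1 * M := by
        gcongr
        exact h0 0 (by omega)
      have h4 : A * M = 1 * M + K * (1 + ‖z‖) * M + K * ((1 + ‖z‖) * M) / (-z.re) := by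
        rw [hA]; ring
      have h5 : 0 ≤ K * (1 + ‖z‖) * M := by positivity
      linarith
    have hEi : ∀ i ≤ n + 1, ∀ t ∈ Icc 0 b, ‖E i t‖ ≤ A * (1 + ‖z‖) ^ i * M := by
      intro i
      induction i with
      | zero => intro _ t ht; simpa using hE0 t ht
      | succ i hi =>
        intro hin t ht
        have h1 := hi (by omega) t ht
        have h2 := hF i (by omega) t ht
        have h3 : 1 ≤ (1 + ‖z‖) ^ i := one_le_pow₀ (by linarith [norm_nonneg z])
        have h4 : K * ((1 + ‖z‖) * M) ≤ A * M := by
          have : 0 ≤ (1 + K * (1 + ‖z‖) / (-z.re)) * M := by positivity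
          rw [hA]
          linarith
        have h5 : A * M ≤ A * (1 + ‖z‖) ^ i * M := by
          have : 0 ≤ A * M := by positivity
          nlinarith
        calc ‖E (i + 1) t‖ = ‖(E (i + 1) t - z * E i t) + z * E i t‖ := by simp
          _ ≤ _ := norm_add_le _ _
          _ ≤ A * (1 + ‖z‖) ^ i * M + ‖z‖ * (A * (1 + ‖z‖) ^ i * M) := by
            rw [norm_mul]
            gcongr
            exact h2.trans (h4.trans h5)
          _ = _ := by ring
    intro i hi t ht
    refine (hEi i hi t ht).trans ?_
    gcongr
    linarith [norm_nonneg z]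

open Polynomial in
theorem tendsto_zero_of_hurwitz_roots (S : Multiset ℂ) (hS : ∀ z ∈ S, z.re < 0) (E : ℕ → ℝ → ℂ)
    (hc : ∀ i < S.card, ContinuousOn (E i) (Ici 0))
    (hd : ∀ i < S.card, ∀ t : ℝ, 0 ≤ t → HasDerivWithinAt (E i) (E (i + 1) t) (Ici t) t)
    (hsum : Tendsto (fun t => ∑ i ∈ Finset.range (S.card + 1),
        ((S.map fun z => X - C z).prod).coeff i * E i t) atTop (𝓝 0)) :
    ∀ i ≤ S.card, Tendsto (E i) atTop (𝓝 0) := by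
  induction S using Multiset.induction_on generalizing E with
  | empty =>
    intro i hi
    obtain rfl : i = 0 := by simpa using hi
    simpa using hsum
  | cons z S ih =>
    have hz := hS z (Multiset.mem_cons_self z S)
    rw [Multiset.card_cons] at hc hd hsum ⊢
    rw [Multiset.map_cons, Multiset.prod_cons] at hsum
    have hF : ∀ i ≤ S.card, Tendsto (fun t => E (i + 1) t - z * E i t) atTop (𝓝 0) := by
      refine ih (fun w hw => hS w (Multiset.mem_cons_of_mem hw))
        (fun i t => E (i + 1) t - z * E i t) ?_ ?_ ?_
      · intro i hi
        exact (hc (i + 1) (by omega)).sub (continuousOn_const.mul (hc i (by omega)))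
      · intro i hi t ht
        exact (hd (i + 1) (by omega) t ht).sub ((hd i (by omega) t ht).const_mul z)
      · refine hsum.congr fun t => ?_
        exact sum_coeff_X_sub_C_mul z (natDegree_multiset_prod_X_sub_C_eq_card S) (fun i => E i t)
    intro i
    induction i with
    | zero =>
      intro _
      exact tendsto_zero_of_stable hz (hc 0 (by omega))
        (v := fun t => E (0 + 1) t - z * E 0 t)
        (fun t ht => by simpa using hd 0 (by omega) t ht) (hF 0 (by omega))
    | succ i hi =>
      intro hin
      have := (hF i (by omega)).add ((hi (by omega)).const_mul z)
      simpa using this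

open Polynomial in
/-- A real Hurwitz polynomial `z^r + ∑ lam i z^i` is given by its `r` roots in the open left
half plane. -/
theorem exists_roots_of_hurwitz {r : ℕ} (lam : Fin r → ℝ)
    (h : ∀ z : ℂ, z ^ r + ∑ i : Fin r, (lam i : ℂ) * z ^ (i : ℕ) = 0 → z.re < 0) :
    ∃ S : Multiset ℂ, S.card = r ∧ (∀ z ∈ S, z.re < 0) ∧
      ∀ E : ℕ → ℂ, ∑ i ∈ Finset.range (r + 1), ((S.map fun z => X - C z).prod).coeff i * E i =
        (∑ i : Fin r, (lam i : ℂ) * E i) + E r := by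
  set q : ℂ[X] := ∑ i : Fin r, C (lam i : ℂ) * X ^ (i : ℕ) with hq
  have hqdeg : q.degree < r := by
    rw [degree_lt_iff_coeff_zero]
    intro k hk
    rw [hq, finsetSum_coeff]
    refine Finset.sum_eq_zero fun i _ => ?_
    rw [coeff_C_mul_X_pow, if_neg (by omega)]
  set p : ℂ[X] := X ^ r + q with hp
  have hmon : p.Monic := monic_X_pow_add hqdeg
  have hdeg : p.natDegree = r := by
    refine natDegree_eq_of_degree_eq_some ?_
    rw [hp, degree_add_eq_left_of_degree_lt (by rwa [degree_X_pow]), degree_X_pow]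
  have hsplit : p.Splits := IsAlgClosed.splits p
  have hprod : (p.roots.map fun z => X - C z).prod = p := by
    have := hsplit.eq_prod_roots
    rw [hmon.leadingCoeff] at this
    simpa using this.symm
  have hcard : p.roots.card = r := by rw [← hdeg]; exact hsplit.natDegree_eq_card_roots.symm
  refine ⟨p.roots, hcard, fun z hz => h z ?_, fun E => ?_⟩
  · have := (mem_roots'.1 hz).2
    simpa [IsRoot, hp, hq, eval_finsetSum] using this
  · have hcr : p.coeff r = 1 := by rw [← hdeg]; exact hmon.coeff_natDegree
    have hci : ∀ i : Fin r, p.coeff i = lam i := by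
      intro i
      rw [hp, coeff_add, coeff_X_pow, if_neg i.2.ne, hq, finsetSum_coeff]
      simp [Fin.val_inj]
    rw [hprod, Finset.sum_range_succ, Finset.sum_range, hcr]
    simp [hci]

end StableFilter

/-! ### Nussbaum functions of type BL -/

section Nussbaum

/-- For L' strictly between p / q and L, infinitely often A > L' B, so that p B - q A ≤ -δ A with δ
> 0. Since A outgrows every multiple of z, this beats the term z. -/
theorem frequently_lt_of_limsup_ratio {A B : ℝ → ℝ} {L p q : ℝ} (hp : 0 < p) (hq : 0 < q)
    (hpq : p / q < L) (hA : Tendsto (fun z => A z / z) atTop atTop)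
    (hB : Tendsto (fun z => B z / z) atTop atTop)
    (hlim : (L : EReal) ≤ limsup (fun z => ((A z / B z : ℝ) : EReal)) atTop) (D : ℝ) :
    ∃ᶠ z in atTop, z + 1 / 2 * (p * B z - q * A z) < D := by
  obtain ⟨L', h1, h2⟩ := exists_between hpq
  have hfreq : ∃ᶠ z in atTop, (L' : EReal) < ((A z / B z : ℝ) : EReal) :=
    frequently_lt_of_lt_limsup (by isBoundedDefault)
      ((EReal.coe_lt_coe_iff.2 h2).trans_le hlim)
  have hL' : 0 < L' := (div_pos hp hq).trans h1
  set δ := q - p / L' with hδ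
  have hδ0 : 0 < δ := by
    rw [hδ, sub_pos, div_lt_iff₀ hL']
    rwa [div_lt_iff₀ hq, mul_comm] at h1
  -- The threshold 4 / δ yields δ A ≥ 4 z, so the expression is at most -z, which is below D.
  refine (hfreq.and_eventually ((hA.eventually_ge_atTop (4 / δ)).and
    ((hB.eventually_ge_atTop 1).and (eventually_gt_atTop (max 0 (-D)))))).mono ?_
  rintro z ⟨hz1, hz2, hz3, hz4⟩
  have hz0 : 0 < z := (le_max_left _ _).trans_lt hz4
  have hzD : -D < z := (le_max_right _ _).trans_lt hz4
  rw [EReal.coe_lt_coe_iff] at hz1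
  rw [le_div_iff₀ hz0] at hz2 hz3
  have hB0 : 0 < B z := by linarith
  rw [lt_div_iff₀ hB0] at hz1
  have h3 : p * B z ≤ p / L' * A z := by
    rw [div_mul_eq_mul_div, le_div_iff₀ hL']
    nlinarith
  have h4 : 4 * z ≤ δ * A z := by
    have := mul_le_mul_of_nonneg_left hz2 hδ0.le
    rwa [← mul_assoc, mul_div_cancel₀ _ hδ0.ne'] at this
  have h5 : δ * A z = q * A z - p / L' * A z := by rw [hδ]; ring
  linarith

/-- The property of a Nussbaum function of type `BL` which the stability proof uses. -/
theorem IsNussbaumBL.exists_lt {L : ℝ} {h : ℝ → ℝ} (hh : IsNussbaumBL L h) {lo hi : ℝ}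
    (hsign : 0 < lo * hi) (hL : max (lo / hi) (hi / lo) < L) (R D : ℝ) :
    ∃ Z : ℝ, R < Z ∧ Z + 1 / 2 * (hi * (∫ τ in (0 : ℝ)..Z, max 0 (h τ)) -
      lo * (∫ τ in (0 : ℝ)..Z, max 0 (-h τ))) < D := by
  rw [max_lt_iff] at hL
  -- With positive gains H⁻ has to dominate and the critical ratio is hi / lo; with negative gains
  -- the roles are exchanged and it is lo / hi.
  rcases pos_and_pos_or_neg_and_neg_of_mul_pos hsign with ⟨hlo, hhi⟩ | ⟨hlo, hhi⟩
  · have := (frequently_lt_of_limsup_ratio hhi hlo hL.2 hh.neg_tendsto hh.pos_tendsto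
      hh.neg_limsup D).and_eventually (eventually_gt_atTop R)
    obtain ⟨Z, h1, h2⟩ := this.exists
    exact ⟨Z, h2, h1⟩
  · have := (frequently_lt_of_limsup_ratio (neg_pos.2 hlo) (neg_pos.2 hhi)
      (by rw [neg_div_neg_eq]; exact hL.1) hh.pos_tendsto hh.neg_tendsto
      hh.pos_limsup D).and_eventually (eventually_gt_atTop R)
    obtain ⟨Z, h1, h2⟩ := this.exists
    exact ⟨Z, h2, by linarith⟩

end Nussbaum

/-! ### The error chain, coordinate by coordinate -/

section ErrorChain

variable {r m : ℕ}

/-- The `j`-th coordinates of a chain of `r + 1` vector signals, as complex numbers. -/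
noncomputable def complexChain (e : ℝ → Fin (r + 1) → Vec m) (j : Fin m) (i : ℕ) (t : ℝ) : ℂ :=
  if hi : i < r + 1 then ((e t ⟨i, hi⟩ j : ℝ) : ℂ) else 0

theorem complexChain_val (e : ℝ → Fin (r + 1) → Vec m) (j : Fin m) (i : Fin (r + 1)) (t : ℝ) :
    complexChain e j i t = ((e t i j : ℝ) : ℂ) := by
  rw [complexChain, dif_pos i.2]

theorem abs_apply_le_norm (v : Vec m) (j : Fin m) : |v j| ≤ ‖v‖ := PiLp.norm_apply_le v j

theorem norm_le_sum_abs (v : Vec m) : ‖v‖ ≤ ∑ j, |v j| := by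
  rw [EuclideanSpace.norm_eq]
  refine Real.sqrt_le_iff.2 ⟨Finset.sum_nonneg fun _ _ => abs_nonneg _, ?_⟩
  exact Finset.sum_sq_le_sq_sum_of_nonneg fun _ _ => abs_nonneg _

theorem hasDerivWithinAt_complexChain {e : ℝ → Fin (r + 1) → Vec m} {s : Set ℝ} {t : ℝ}
    (h : ∀ i : Fin r, HasDerivWithinAt (fun τ => e τ i.castSucc) (e t i.succ) s t) (j : Fin m)
    {i : ℕ} (hi : i < r) :
    HasDerivWithinAt (complexChain e j i) (complexChain e j (i + 1) t) s t := by
  have h1 := ((EuclideanSpace.proj (𝕜 := ℝ) j).hasFDerivAt.comp_hasDerivWithinAt t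
    (h ⟨i, hi⟩)).ofReal_comp
  have h2 : complexChain e j i = fun τ => ((e τ (Fin.castSucc ⟨i, hi⟩) j : ℝ) : ℂ) :=
    funext fun τ => complexChain_val e j (Fin.castSucc ⟨i, hi⟩) τ
  have h3 : complexChain e j (i + 1) t = ((e t (Fin.succ ⟨i, hi⟩) j : ℝ) : ℂ) :=
    complexChain_val e j (Fin.succ ⟨i, hi⟩) t
  rw [h2, h3]
  exact h1

theorem sum_complexChain (lam : Fin r → ℝ) (e : ℝ → Fin (r + 1) → Vec m) (j : Fin m) (t : ℝ) :
    (∑ i : Fin r, (lam i : ℂ) * complexChain e j i t) + complexChain e j r t =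
      ((((∑ i : Fin r, lam i • e t i.castSucc) + e t (Fin.last r)) j : ℝ) : ℂ) := by
  have h1 := complexChain_val e j (Fin.last r) t
  rw [Fin.val_last] at h1
  have h2 : ∀ i : Fin r, complexChain e j i t = ((e t i.castSucc j : ℝ) : ℂ) := fun i =>
    complexChain_val e j i.castSucc t
  simp [h1, h2]

/-- A Hurwitz filter with a bounded input has bounded states. -/
theorem exists_bound_of_hurwitz (m : ℕ) (lam : Fin r → ℝ)
    (h : ∀ z : ℂ, z ^ r + ∑ i : Fin r, (lam i : ℂ) * z ^ (i : ℕ) = 0 → z.re < 0) :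
    ∃ K : ℝ, 0 ≤ K ∧ ∀ (b M : ℝ) (e : ℝ → Fin (r + 1) → Vec m), 0 ≤ b → 0 ≤ M →
      (∀ i : Fin r, ∀ t ∈ Icc 0 b,
        HasDerivWithinAt (fun τ => e τ i.castSucc) (e t i.succ) (Icc 0 b) t) →
      (∀ i, ‖e 0 i‖ ≤ M) →
      (∀ t ∈ Icc 0 b, ‖(∑ i : Fin r, lam i • e t i.castSucc) + e t (Fin.last r)‖ ≤ M) →
      ∀ i, ∀ t ∈ Icc 0 b, ‖e t i‖ ≤ K * M := by
  obtain ⟨S, hcard, hS, hsum⟩ := exists_roots_of_hurwitz lam h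
  obtain ⟨K, hK, hbd⟩ := exists_bound_of_hurwitz_roots S hS
  rw [hcard] at hbd
  refine ⟨m * K, by positivity, fun b M e hb hM hd h0 hs i t ht => ?_⟩
  have key : ∀ j : Fin m, |e t i j| ≤ K * M := by
    intro j
    have h1 := hbd b M (complexChain e j) hb hM
      (fun i hi t ht =>
        (hasDerivWithinAt_complexChain (fun i => hd i t ht) j hi).continuousWithinAt)
      (fun i hi t ht => by
        refine (hasDerivWithinAt_complexChain
          (fun i => hd i t ⟨ht.1, ht.2.le⟩) j hi).mono_of_mem_nhdsWithin ?_
        filter_upwards [self_mem_nhdsWithin, nhdsWithin_le_nhds (Iio_mem_nhds ht.2)] with τ h1 h2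
        exact ⟨ht.1.trans h1, h2.le⟩)
      (fun i hi => by
        have := complexChain_val e j ⟨i, by omega⟩ 0
        simp only at this
        rw [this, Complex.norm_real]
        exact (abs_apply_le_norm _ j).trans (h0 _))
      (fun t ht => by
        rw [hsum fun i => complexChain e j i t, sum_complexChain, Complex.norm_real]
        exact (abs_apply_le_norm _ j).trans (hs t ht))
      i (by omega) t ht
    rwa [complexChain_val, Complex.norm_real] at h1
  calc ‖e t i‖ ≤ ∑ j, |e t i j| := norm_le_sum_abs _
    _ ≤ ∑ _j : Fin m, K * M := Finset.sum_le_sum fun j _ => key j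
    _ = _ := by simp [mul_assoc]

/-- A Hurwitz filter with a vanishing input has vanishing states. -/
theorem tendsto_zero_of_hurwitz (lam : Fin r → ℝ)
    (h : ∀ z : ℂ, z ^ r + ∑ i : Fin r, (lam i : ℂ) * z ^ (i : ℕ) = 0 → z.re < 0)
    {e : ℝ → Fin (r + 1) → Vec m}
    (hd : ∀ i : Fin r, ∀ t : ℝ, 0 ≤ t →
      HasDerivWithinAt (fun τ => e τ i.castSucc) (e t i.succ) (Ici 0) t)
    (hs : Tendsto (fun t => (∑ i : Fin r, lam i • e t i.castSucc) + e t (Fin.last r))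
      atTop (𝓝 0)) (i : Fin (r + 1)) :
    Tendsto (fun t => e t i) atTop (𝓝 0) := by
  obtain ⟨S, hcard, hS, hsum⟩ := exists_roots_of_hurwitz lam h
  have key : ∀ j : Fin m, Tendsto (fun t => |e t i j|) atTop (𝓝 0) := by
    intro j
    have h1 := tendsto_zero_of_hurwitz_roots S hS (complexChain e j)
      (fun i hi t ht => (hasDerivWithinAt_complexChain (fun i => hd i t ht) j
        (hcard ▸ hi)).continuousWithinAt)
      (fun i hi t ht => (hasDerivWithinAt_complexChain (fun i => hd i t ht) j
        (hcard ▸ hi)).mono (Ici_subset_Ici.2 ht))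
      (by
        rw [hcard]
        simp only [hsum, sum_complexChain]
        rw [tendsto_zero_iff_norm_tendsto_zero] at hs ⊢
        refine squeeze_zero (fun _ => norm_nonneg _) (fun t => ?_) hs
        rw [Complex.norm_real]
        exact abs_apply_le_norm _ j)
      i (by omega)
    rw [tendsto_zero_iff_norm_tendsto_zero] at h1
    refine h1.congr fun t => ?_
    rw [complexChain_val, Complex.norm_real, Real.norm_eq_abs]
  rw [tendsto_zero_iff_norm_tendsto_zero]
  refine squeeze_zero (fun _ => norm_nonneg _) (fun t => norm_le_sum_abs (e t i)) ?_
  simpa using tendsto_finsetSum Finset.univ fun j _ => key j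

end ErrorChain

/-! ### Matrices acting on Euclidean vectors -/

section MatrixAction

variable {m : ℕ}

/-- `A ↦ (v ↦ A v)` as a continuous linear map. -/
noncomputable def actCLM (m : ℕ) : Mat m →L[ℝ] Vec m →L[ℝ] Vec m :=
  LinearMap.mkContinuous
    { toFun := fun A => Matrix.toEuclideanCLM (n := Fin m) (𝕜 := ℝ) A
      map_add' := fun A B => map_add _ A B
      map_smul' := fun c A => map_smul _ c A } 1 fun A => by
    simp [Matrix.l2_opNorm_toEuclideanCLM]

theorem actCLM_apply (A : Mat m) (v : Vec m) : actCLM m A v = act A v := rfl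

theorem norm_act_le (A : Mat m) (v : Vec m) : ‖act A v‖ ≤ ‖A‖ * ‖v‖ :=
  A.l2_opNorm_mulVec v

theorem act_add (A : Mat m) (v w : Vec m) : act A (v + w) = act A v + act A w :=
  (actCLM m A).map_add v w

theorem act_smul (A : Mat m) (c : ℝ) (v : Vec m) : act A (c • v) = c • act A v :=
  (actCLM m A).map_smul c v

theorem add_act (A B : Mat m) (v : Vec m) : act (A + B) v = act A v + act B v := by
  simp [← actCLM_apply]

theorem sub_act (A B : Mat m) (v : Vec m) : act (A - B) v = act A v - act B v := by
  simp [← actCLM_apply]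

theorem smul_one_act (c : ℝ) (v : Vec m) : act (c • (1 : Mat m)) v = c • v := by
  simp [act, Matrix.smul_mulVec]

theorem mul_act (A B : Mat m) (v : Vec m) : act (A * B) v = act A (act B v) := by
  simp [act, Matrix.mulVec_mulVec]

theorem inner_act (A : Mat m) (v w : Vec m) : inner ℝ v (act A w) = v.ofLp ⬝ᵥ A *ᵥ w.ofLp :=
  Matrix.inner_toEuclideanCLM A v w

theorem inner_act_transpose (A : Mat m) (v w : Vec m) :
    inner ℝ v (act Aᵀ w) = inner ℝ w (act A v) := by
  rw [inner_act, inner_act, Matrix.mulVec_transpose, dotProduct_comm,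
    Matrix.dotProduct_mulVec]

theorem abs_inner_act_le (A : Mat m) (v w : Vec m) : |inner ℝ v (act A w)| ≤ ‖v‖ * (‖A‖ * ‖w‖) :=
  (abs_real_inner_le_norm _ _).trans (by gcongr; exact norm_act_le A w)

theorem inner_act_nonneg {A : Mat m} (hA : A.PosSemidef) (v : Vec m) :
    0 ≤ inner ℝ v (act A v) := by
  rw [inner_act]
  exact hA.dotProduct_mulVec_nonneg v.ofLp

theorem mul_norm_sq_le_inner_act {A : Mat m} {c : ℝ} (hA : (A - c • (1 : Mat m)).PosSemidef)
    (v : Vec m) : c * ‖v‖ ^ 2 ≤ inner ℝ v (act A v) := by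
  have := inner_act_nonneg hA v
  rwa [sub_act, smul_one_act, inner_sub_right, real_inner_smul_right,
    real_inner_self_eq_norm_sq, sub_nonneg] at this

theorem inner_act_le_mul_norm_sq {A : Mat m} {c : ℝ} (hA : (c • (1 : Mat m) - A).PosSemidef)
    (v : Vec m) : inner ℝ v (act A v) ≤ c * ‖v‖ ^ 2 := by
  have := inner_act_nonneg hA v
  rwa [sub_act, smul_one_act, inner_sub_right, real_inner_smul_right,
    real_inner_self_eq_norm_sq, sub_nonneg] at this

theorem norm_act_diagonal_le {ρ : Fin m → ℝ} (hρ : ∀ j, ρ j ∈ Ioc (0 : ℝ) 1) (v : Vec m) :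
    ‖act (Matrix.diagonal ρ) v‖ ≤ ‖v‖ := by
  refine (norm_act_le _ v).trans (mul_le_of_le_one_left (norm_nonneg v) ?_)
  rw [Matrix.l2_opNorm_diagonal]
  refine (pi_norm_le_iff_of_nonneg zero_le_one).2 fun j => ?_
  rw [Real.norm_eq_abs, abs_of_pos (hρ j).1]
  exact (hρ j).2

end MatrixAction

/-- All the standing assumptions on the plant and the control algorithm, except for the ones on the
Nussbaum function. -/
structure Admissible {r m : ℕ} (P : Plant r m) (C : Controller r m)
    (α : (Fin r → Vec m) → ℝ → Mat m) (c lo hi af a₁ a₂ : ℝ) : Prop where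
  reference : C.GoodReference
  design : C.GoodDesign
  bounds : C.GoodBounds
  faults : P.Faults
  controllable : P.Controllable α c lo hi
  growth : P.Growth C α af a₁ a₂

/-- The constant `a` dominates all the unknown constants of the closed loop, so that `a φ ‖s‖` is
at least the part of the energy rate that the control does not influence. -/
structure IsGainBound {r m : ℕ} (C : Controller r m) (af a₁ a₂ a : ℝ) : Prop where
  size : a₁ ≤ a
  drift : a₁ * af ≤ a
  rate : a₂ ≤ a
  reference : ∀ t : ℝ, 0 ≤ t → a₁ * ‖iteratedDerivWithin (r + 1) C.y (Ici 0) t‖ ≤ a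

/-- The right side exceeds the left by ν² / (w + ν). With w = φ‖s‖ this trades the unknown term a w
for a multiple of the adaptation rate plus aν. The case w = 0 is separate because w + ν may vanish.
-/
theorem le_sq_div_add {w ν : ℝ} (hw : 0 ≤ w) (hν : 0 ≤ ν) : w ≤ w ^ 2 / (w + ν) + ν := by
  rcases hw.eq_or_lt with rfl | hw
  · simpa using hν
  · have h1 : 0 < w + ν := by linarith
    have h2 : w ^ 2 / (w + ν) + ν - w = ν ^ 2 / (w + ν) := by
      field_simp
      ring
    have h3 : 0 ≤ ν ^ 2 / (w + ν) := by positivity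
    linarith

theorem sq_div_add_le {w ν : ℝ} (hw : 0 ≤ w) (hν : 0 ≤ ν) : w ^ 2 / (w + ν) ≤ w := by
  rcases hw.eq_or_lt with rfl | hw
  · simp
  · rw [div_le_iff₀ (by linarith)]
    nlinarith

/-! ### Gains, adaptation rates and the energy -/

namespace Controller

variable {r m : ℕ} {C : Controller r m}

theorem GoodReference.exists_bound (hy : C.GoodReference) :
    ∃ K : ℝ, 0 ≤ K ∧ ∀ i ≤ r + 1, ∀ t : ℝ, 0 ≤ t →
      ‖iteratedDerivWithin i C.y (Ici 0) t‖ ≤ K := by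
  choose! K hK using hy.bounded
  refine ⟨∑ i ∈ Finset.range (r + 2), |K i|, Finset.sum_nonneg fun _ _ => abs_nonneg _,
    fun i hi t ht => (hK i hi t ht).trans ((le_abs_self _).trans ?_)⟩
  exact Finset.single_le_sum (f := fun i => |K i|) (fun _ _ => abs_nonneg _)
    (Finset.mem_range.2 (by omega))

theorem GoodReference.hasDerivWithinAt (hy : C.GoodReference) {i : ℕ} (hi : i ≤ r) {t : ℝ}
    (ht : 0 ≤ t) : HasDerivWithinAt (iteratedDerivWithin i C.y (Ici 0))
      (iteratedDerivWithin (i + 1) C.y (Ici 0) t) (Ici 0) t := by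
  rw [iteratedDerivWithin_succ]
  exact (hy.differentiable i hi t ht).hasDerivWithinAt

theorem exists_isGainBound (hy : C.GoodReference) {a₁ : ℝ} (ha : 0 ≤ a₁) (af a₂ : ℝ) :
    ∃ a : ℝ, IsGainBound C af a₁ a₂ a := by
  obtain ⟨K, hK, hyK⟩ := hy.exists_bound
  refine ⟨max (max a₁ (a₁ * af)) (max a₂ (a₁ * K)), ?_, ?_, ?_, fun t ht => ?_⟩
  · exact (le_max_left _ _).trans (le_max_left _ _)
  · exact (le_max_right _ _).trans (le_max_left _ _)
  · exact (le_max_left _ _).trans (le_max_right _ _)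
  · refine le_trans ?_ ((le_max_right _ _).trans (le_max_right _ _))
    gcongr
    exact hyK (r + 1) le_rfl t ht

/-- The scalar gain `κ` with `η = κ s`. -/
noncomputable def gain (C : Controller r m) (x : Fin (r + 1) → Vec m) (θ t : ℝ) : ℝ :=
  C.k + θ * C.core x t ^ 2 / (C.core x t * ‖C.filt x t‖ + C.ν t)

theorem eta_eq (x : Fin (r + 1) → Vec m) (θ t : ℝ) :
    C.eta x θ t = C.gain x θ t • C.filt x t := by
  rw [eta, gain, add_smul]

theorem control_eq (x : Fin (r + 1) → Vec m) (ζ θ t : ℝ) :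
    C.control x ζ θ t = (C.h ζ * C.gain x θ t) • C.filt x t := by
  rw [control, eta_eq, smul_smul]

theorem core_nonneg (hφ : C.GoodBounds) (x : Fin (r + 1) → Vec m) (t : ℝ) : 0 ≤ C.core x t := by
  have h1 := hφ.φ₁_nonneg (lower x)
  have h2 := hφ.φ₂_nonneg x
  have h3 := hφ.φf_nonneg x
  rw [core]
  positivity

theorem gain_nonneg (hC : C.GoodDesign) (hφ : C.GoodBounds) (x : Fin (r + 1) → Vec m) {θ t : ℝ}
    (hθ : 0 ≤ θ) (ht : 0 ≤ t) : 0 ≤ C.gain x θ t := by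
  have h1 := core_nonneg hφ x t
  have h2 := hC.ν_nonneg t ht
  have h3 := hC.k_pos
  rw [gain]
  positivity

theorem ζRate_eq (x : Fin (r + 1) → Vec m) (θ t : ℝ) :
    C.ζRate x θ t = C.σ₁ * (C.gain x θ t * ‖C.filt x t‖ ^ 2) := by
  rw [ζRate, eta_eq, real_inner_smul_right, real_inner_self_eq_norm_sq]

theorem θRate_eq (x : Fin (r + 1) → Vec m) (t : ℝ) :
    C.θRate x t = C.σ₂ * ((C.core x t * ‖C.filt x t‖) ^ 2 /
      (C.core x t * ‖C.filt x t‖ + C.ν t)) := by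
  rw [θRate]
  ring

/-- This ties the two adaptive laws together: the term θ̂ θ̂' / σ₂, left over by the parameter error
in the Lyapunov estimate, is part of ζ' / σ₁. -/
theorem ζRate_div_eq (hC : C.GoodDesign) (x : Fin (r + 1) → Vec m) (θ t : ℝ) :
    C.ζRate x θ t / C.σ₁ = C.k * ‖C.filt x t‖ ^ 2 + θ * (C.θRate x t / C.σ₂) := by
  rw [ζRate_eq, θRate_eq, mul_div_cancel_left₀ _ hC.σ₁_pos.ne',
    mul_div_cancel_left₀ _ hC.σ₂_pos.ne', gain]
  ring

theorem θRate_nonneg (hC : C.GoodDesign) (hφ : C.GoodBounds) (x : Fin (r + 1) → Vec m) {t : ℝ}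
    (ht : 0 ≤ t) : 0 ≤ C.θRate x t := by
  have h1 := core_nonneg hφ x t
  have h2 := hC.ν_nonneg t ht
  have h3 := hC.σ₂_pos
  rw [θRate]
  positivity

theorem ζRate_nonneg (hC : C.GoodDesign) (hφ : C.GoodBounds) (x : Fin (r + 1) → Vec m) {θ t : ℝ}
    (hθ : 0 ≤ θ) (ht : 0 ≤ t) : 0 ≤ C.ζRate x θ t := by
  have h1 := gain_nonneg hC hφ x hθ ht
  have h2 := hC.σ₁_pos
  rw [ζRate_eq]
  positivity

/-- The energy `sᵀ α s / 2`. -/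
noncomputable def energy (C : Controller r m) (α : (Fin r → Vec m) → ℝ → Mat m)
    (x : Fin (r + 1) → Vec m) (t : ℝ) : ℝ :=
  1 / 2 * inner ℝ (C.filt x t) (act (α (lower x) t) (C.filt x t))

/-- The rate of the filtered error `s` along the closed loop. -/
noncomputable def filtRate (C : Controller r m) (P : Plant r m) (x : Fin (r + 1) → Vec m)
    (ζ θ t : ℝ) : Vec m :=
  C.Phi x t + (P.f x + act (P.g x t) (P.actuator t (C.control x ζ θ t)) + P.d x t) -
    iteratedDerivWithin (r + 1) C.y (Ici 0) t

/-- The rate of `α` along the motion. -/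
noncomputable def matRate (α : (Fin r → Vec m) → ℝ → Mat m) (x : Fin (r + 1) → Vec m) (t : ℝ) :
    Mat m :=
  fderivWithin ℝ (fun p : (Fin r → Vec m) × ℝ => α p.1 p.2) (univ ×ˢ Ici 0)
    (lower x, t) (upper x, 1)

/-- The rate of the energy along the closed loop. -/
noncomputable def energyRate (C : Controller r m) (P : Plant r m)
    (α : (Fin r → Vec m) → ℝ → Mat m) (x : Fin (r + 1) → Vec m) (ζ θ t : ℝ) : ℝ :=
  inner ℝ (C.filt x t) (act (α (lower x) t) (C.filtRate P x ζ θ t)) +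
    1 / 2 * inner ℝ (C.filt x t) (act (matRate α x t) (C.filt x t))

end Controller

/-! ### Bounds for the energy and its rate -/

section Energy

variable {r m : ℕ} {P : Plant r m} {C : Controller r m} {α : (Fin r → Vec m) → ℝ → Mat m}
  {c lo hi af a₁ a₂ a : ℝ}

/-- By symmetry of α the two summands of the gain are transposes of each other. Hence the skew part
of α g ρ, on which nothing is assumed, does not affect the energy. -/
theorem inner_symGain (hα : P.Controllable α c lo hi) (x : Fin (r + 1) → Vec m) {t : ℝ}
    (ht : 0 ≤ t) (v : Vec m) :
    inner ℝ v (act (P.symGain α x t) v) =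
      2 * inner ℝ v (act (α (lower x) t)
        (act (P.g x t) (act (Matrix.diagonal (P.ρ t)) v))) := by
  have h1 : P.symGain α x t = α (lower x) t * P.g x t * Matrix.diagonal (P.ρ t) +
      (α (lower x) t * P.g x t * Matrix.diagonal (P.ρ t))ᵀ := by
    rw [Plant.symGain, Matrix.transpose_mul, Matrix.transpose_mul, (hα.symm (lower x) t ht).eq,
      Matrix.diagonal_transpose]
    simp only [Matrix.mul_assoc]
  rw [h1, add_act, inner_add_right, inner_act_transpose, mul_act, mul_act]
  ring

theorem energyRate_le (H : Admissible P C α c lo hi af a₁ a₂) (ha : IsGainBound C af a₁ a₂ a)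
    (x : Fin (r + 1) → Vec m) (ζ : ℝ) {θ t : ℝ} (hθ : 0 ≤ θ) (ht : 0 ≤ t) :
    C.energyRate P α x ζ θ t ≤ a * (C.core x t * ‖C.filt x t‖) +
      1 / 2 * (hi * max 0 (C.h ζ) - lo * max 0 (-C.h ζ)) * (C.ζRate x θ t / C.σ₁) := by
  set s := C.filt x t with hs
  set A := α (lower x) t with hA
  set κ := C.gain x θ t with hκ
  set y := iteratedDerivWithin (r + 1) C.y (Ici 0) t with hyd
  set w := P.f x + act (P.g x t) (P.ε t) + P.d x t with hw
  have hκ0 : 0 ≤ κ := Controller.gain_nonneg H.design H.bounds x hθ ht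
  have hsplit : C.filtRate P x ζ θ t = (C.Phi x t + w - y) +
      (C.h ζ * κ) • act (P.g x t) (act (Matrix.diagonal (P.ρ t)) s) := by
    rw [Controller.filtRate, Plant.actuator, act_add, Controller.control_eq, act_smul, act_smul, hw]
    abel
  have hfree : inner ℝ s (act A (C.Phi x t + w - y)) ≤
      a * (C.φ₁ (lower x) * (‖C.Phi x t‖ + C.φf x + 1)) * ‖s‖ := by
    have h1 : ‖C.Phi x t + w - y‖ ≤ ‖C.Phi x t‖ + af * C.φf x + ‖y‖ := by
      refine (norm_sub_le _ _).trans ?_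
      gcongr
      refine (norm_add_le _ _).trans ?_
      gcongr
      exact H.growth.drift x t ht
    have h2 : ‖A‖ ≤ a₁ * C.φ₁ (lower x) := H.growth.size (lower x) t ht
    have h3 := H.bounds.φ₁_nonneg (lower x)
    have h4 := H.bounds.φf_nonneg x
    have h5 := H.growth.a₁_pos
    -- The summand 1 in φ is there to absorb the n-th derivative of the reference.
    have h6 : a₁ * (‖C.Phi x t‖ + af * C.φf x + ‖y‖) ≤
        a * (‖C.Phi x t‖ + C.φf x + 1) := by
      have e1 := mul_le_mul_of_nonneg_right ha.size (norm_nonneg (C.Phi x t))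
      have e2 := mul_le_mul_of_nonneg_right ha.drift h4
      have e3 := ha.reference t ht
      rw [← hyd] at e3
      linarith
    calc _ ≤ ‖s‖ * (‖A‖ * ‖C.Phi x t + w - y‖) :=
          (le_abs_self _).trans (abs_inner_act_le A _ _)
      _ ≤ ‖s‖ * (a₁ * C.φ₁ (lower x) * (‖C.Phi x t‖ + af * C.φf x + ‖y‖)) := by gcongr
      _ = ‖s‖ * C.φ₁ (lower x) * (a₁ * (‖C.Phi x t‖ + af * C.φf x + ‖y‖)) := by ring
      _ ≤ ‖s‖ * C.φ₁ (lower x) * (a * (‖C.Phi x t‖ + C.φf x + 1)) := by gcongr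
      _ = _ := by ring
  have hmat : inner ℝ s (act (Controller.matRate α x t) s) ≤ a * C.φ₂ x * ‖s‖ ^ 2 := by
    have h1 : ‖Controller.matRate α x t‖ ≤ a * C.φ₂ x :=
      (H.growth.rate x t ht).trans
        (mul_le_mul_of_nonneg_right ha.rate (H.bounds.φ₂_nonneg x))
    calc _ ≤ ‖s‖ * (‖Controller.matRate α x t‖ * ‖s‖) :=
          (le_abs_self _).trans (abs_inner_act_le _ _ _)
      _ ≤ ‖s‖ * (a * C.φ₂ x * ‖s‖) := by gcongr
      _ = _ := by ring
  set Q := inner ℝ s (act (P.symGain α x t) s) with hQ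
  have hQlo : lo * ‖s‖ ^ 2 ≤ Q := mul_norm_sq_le_inner_act (H.controllable.gain_lower x t ht) s
  have hQhi : Q ≤ hi * ‖s‖ ^ 2 := inner_act_le_mul_norm_sq (H.controllable.gain_upper x t ht) s
  have hctrl : inner ℝ s (act A ((C.h ζ * κ) • act (P.g x t)
      (act (Matrix.diagonal (P.ρ t)) s))) = 1 / 2 * (C.h ζ * (κ * Q)) := by
    rw [act_smul, real_inner_smul_right, hQ, inner_symGain H.controllable x ht]
    ring
  have hrate : C.ζRate x θ t / C.σ₁ = κ * ‖s‖ ^ 2 := by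
    rw [Controller.ζRate_eq, mul_div_cancel_left₀ _ H.design.σ₁_pos.ne']
  have hnuss : C.h ζ * (κ * Q) ≤
      (hi * max 0 (C.h ζ) - lo * max 0 (-C.h ζ)) * (κ * ‖s‖ ^ 2) := by
    have h1 := mul_le_mul_of_nonneg_left hQlo hκ0
    have h2 := mul_le_mul_of_nonneg_left hQhi hκ0
    -- A positive ħ meets the upper gain bound, a negative one the lower.
    rcases le_total 0 (C.h ζ) with h | h
    · rw [max_eq_right h, max_eq_left (neg_nonpos.2 h)]
      have := mul_le_mul_of_nonneg_left h2 h
      linarith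
    · rw [max_eq_left h, max_eq_right (neg_nonneg.2 h)]
      have := mul_le_mul_of_nonneg_left h1 (neg_nonneg.2 h)
      linarith
  rw [Controller.energyRate, hsplit, act_add, inner_add_right, hctrl, hrate, Controller.core]
  linarith

theorem energy_lower (hα : P.Controllable α c lo hi) (x : Fin (r + 1) → Vec m) {t : ℝ}
    (ht : 0 ≤ t) : c / 2 * ‖C.filt x t‖ ^ 2 ≤ C.energy α x t := by
  have := mul_norm_sq_le_inner_act (hα.posDef (lower x) t ht) (C.filt x t)
  rw [Controller.energy]
  linarith

theorem energy_nonneg (hα : P.Controllable α c lo hi) (x : Fin (r + 1) → Vec m) {t : ℝ}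
    (ht : 0 ≤ t) : 0 ≤ C.energy α x t :=
  le_trans (by have := hα.c_pos; positivity) (energy_lower hα x ht)

theorem energy_upper (hg : P.Growth C α af a₁ a₂) (x : Fin (r + 1) → Vec m) {t : ℝ}
    (ht : 0 ≤ t) : C.energy α x t ≤ a₁ * C.φ₁ (lower x) * ‖C.filt x t‖ ^ 2 := by
  have h1 := (le_abs_self _).trans
    (abs_inner_act_le (α (lower x) t) (C.filt x t) (C.filt x t))
  have h2 := mul_le_mul_of_nonneg_right (hg.size (lower x) t ht) (sq_nonneg ‖C.filt x t‖)
  have h3 : 0 ≤ ‖α (lower x) t‖ * ‖C.filt x t‖ ^ 2 := by positivity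
  rw [Controller.energy]
  linarith

end Energy

/-! ### Regularity along a solution -/

namespace IsClosedLoop

variable {r m : ℕ} {P : Plant r m} {C : Controller r m} {α : (Fin r → Vec m) → ℝ → Mat m}
  {c lo hi af a₁ a₂ a : ℝ} {T : EReal} {x : ℝ → Fin (r + 1) → Vec m} {ζ θ : ℝ → ℝ} {b t : ℝ}

theorem mem_horizon (hb : b ∈ horizon T) (ht : t ∈ Icc 0 b) : t ∈ horizon T :=
  ⟨ht.1, (EReal.coe_le_coe_iff.2 ht.2).trans_lt hb.2⟩

theorem continuousOn_state (h : IsClosedLoop P C T x ζ θ) (hb : b ∈ horizon T)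
    (i : Fin (r + 1)) : ContinuousOn (fun τ => x τ i) (Icc 0 b) := by
  have := (h.x_ac b hb i).continuousOn
  rwa [uIcc_of_le hb.1] at this

/-- The rate of each of x₁, …, xₙ₋₁ is the next state, which is continuous, so no exceptional null
set remains. The chain rule for α at every time depends on this. -/
theorem hasDerivWithinAt_state (h : IsClosedLoop P C T x ζ θ) (hb : b ∈ horizon T) (i : Fin r)
    (ht : t ∈ Icc 0 b) : HasDerivWithinAt (fun τ => x τ i.castSucc) (x t i.succ) (Icc 0 b) t := by
  refine hasDerivWithinAt_of_ae_hasDerivAt hb.1 (h.x_ac b hb _) (g := fun τ => x τ i.succ)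
    (h.continuousOn_state hb _) ?_ t ht
  filter_upwards [h.x_chain i] with τ hτ hmem
  exact hτ (mem_horizon hb hmem)

theorem hasDerivWithinAt_err (hy : C.GoodReference) (h : IsClosedLoop P C T x ζ θ)
    (hb : b ∈ horizon T) (i : Fin r) (ht : t ∈ Icc 0 b) :
    HasDerivWithinAt (fun τ => C.err (x τ) τ i.castSucc) (C.err (x t) t i.succ) (Icc 0 b) t :=
  (h.hasDerivWithinAt_state hb i ht).fun_sub
    ((hy.hasDerivWithinAt (by simp) ht.1).mono Icc_subset_Ici_self)

theorem err_ac (hy : C.GoodReference) (h : IsClosedLoop P C T x ζ θ)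
    (hb : b ∈ horizon T) (i : Fin (r + 1)) :
    AbsolutelyContinuousOnInterval (fun τ => C.err (x τ) τ i) 0 b := by
  obtain ⟨K, hK⟩ := hy.bounded (i + 1) (by omega)
  exact (h.x_ac b hb i).fun_sub (absolutelyContinuous_of_norm_derivWithin_le hb.1
    (fun t ht => (hy.hasDerivWithinAt (i := i) (by omega) ht.1).mono Icc_subset_Ici_self)
    fun t ht => hK t ht.1)

theorem filt_ac (hy : C.GoodReference) (h : IsClosedLoop P C T x ζ θ) (hb : b ∈ horizon T) :
    AbsolutelyContinuousOnInterval (fun τ => C.filt (x τ) τ) 0 b := by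
  have h1 : ∀ i ∈ (Finset.univ : Finset (Fin r)), AbsolutelyContinuousOnInterval
      (fun τ => C.lam i • C.err (x τ) τ i.castSucc) 0 b := fun i _ =>
    (h.err_ac hy hb i.castSucc).const_smul (C.lam i)
  unfold Controller.filt
  exact (absolutelyContinuous_sum Finset.univ h1).fun_add (h.err_ac hy hb (Fin.last r))

theorem ae_hasDerivAt_filt (hy : C.GoodReference) (h : IsClosedLoop P C T x ζ θ)
    (hb : b ∈ horizon T) : ∀ᵐ t : ℝ, t ∈ Ioo 0 b →
      HasDerivAt (fun τ => C.filt (x τ) τ) (C.filtRate P (x t) (ζ t) (θ t) t) t := by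
  filter_upwards [h.x_last] with t ht hmem
  have hmem' : t ∈ Icc 0 b := Ioo_subset_Icc_self hmem
  have h1 : ∀ i : Fin r, HasDerivAt (fun τ => C.lam i • C.err (x τ) τ i.castSucc)
      (C.lam i • C.err (x t) t i.succ) t := fun i =>
    ((h.hasDerivWithinAt_err hy hb i hmem').hasDerivAt
      (Icc_mem_nhds hmem.1 hmem.2)).const_smul (C.lam i)
  have h2 := ht (mem_horizon hb hmem')
  have h3 := (hy.hasDerivWithinAt (le_refl r) hmem'.1).hasDerivAt (Ici_mem_nhds hmem.1)
  have h4 := (HasDerivAt.fun_sum fun i (_ : i ∈ Finset.univ) => h1 i).fun_add (h2.fun_sub h3)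
  refine h4.congr_deriv ?_
  rw [Controller.filtRate, Controller.Phi]
  abel

theorem hasDerivWithinAt_mat (H : Admissible P C α c lo hi af a₁ a₂)
    (h : IsClosedLoop P C T x ζ θ) (hb : b ∈ horizon T) (ht : t ∈ Icc 0 b) :
    HasDerivWithinAt (fun τ => α (lower (x τ)) τ) (Controller.matRate α (x t) t)
      (Icc 0 b) t := by
  have h1 : HasDerivWithinAt (fun τ => (lower (x τ), τ)) (upper (x t), (1 : ℝ)) (Icc 0 b) t :=
    (hasDerivWithinAt_pi.2 fun i => h.hasDerivWithinAt_state hb i ht).prodMk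
      (hasDerivWithinAt_id t _)
  have h2 := (H.controllable.differentiable (lower (x t), t)
    ⟨mem_univ _, ht.1⟩).hasFDerivWithinAt
  exact HasFDerivWithinAt.comp_hasDerivWithinAt (f := fun τ => (lower (x τ), τ)) t h2 h1
    fun τ hτ => ⟨mem_univ _, hτ.1⟩

theorem exists_state_bound (h : IsClosedLoop P C T x ζ θ) (hb : b ∈ horizon T) :
    ∃ K : ℝ, ∀ t ∈ Icc 0 b, ‖x t‖ ≤ K :=
  isCompact_Icc.exists_bound_of_continuousOn
    (continuousOn_pi.2 fun i => h.continuousOn_state hb i)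

/-- The rate condition bounds the derivative by a₂ φ₂, and φ₂ is bounded on the compact range of the
state; no Lipschitz property of α itself is needed. -/
theorem mat_ac (H : Admissible P C α c lo hi af a₁ a₂)
    (h : IsClosedLoop P C T x ζ θ) (hb : b ∈ horizon T) :
    AbsolutelyContinuousOnInterval (fun τ => α (lower (x τ)) τ) 0 b := by
  obtain ⟨R, hR⟩ := h.exists_state_bound hb
  obtain ⟨K, hK⟩ := H.bounds.φ₂_bounded R
  refine absolutelyContinuous_of_norm_derivWithin_le (K := a₂ * K) hb.1
    (fun t ht => h.hasDerivWithinAt_mat H hb ht) fun t ht => ?_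
  exact (H.growth.rate (x t) t ht.1).trans
    (mul_le_mul_of_nonneg_left (hK _ (hR t ht)) H.growth.a₂_pos.le)

theorem energy_ac (H : Admissible P C α c lo hi af a₁ a₂)
    (h : IsClosedLoop P C T x ζ θ) (hb : b ∈ horizon T) :
    AbsolutelyContinuousOnInterval (fun τ => C.energy α (x τ) τ) 0 b := by
  have hs := h.filt_ac H.reference hb
  exact (absolutelyContinuous_bilin (innerSL ℝ) hs
    (absolutelyContinuous_bilin (actCLM m) (h.mat_ac H hb) hs)).const_mul (1 / 2)

theorem ae_hasDerivAt_energy (H : Admissible P C α c lo hi af a₁ a₂)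
    (h : IsClosedLoop P C T x ζ θ) (hb : b ∈ horizon T) : ∀ᵐ t : ℝ, t ∈ Ioo 0 b →
      HasDerivAt (fun τ => C.energy α (x τ) τ) (C.energyRate P α (x t) (ζ t) (θ t) t) t := by
  filter_upwards [h.ae_hasDerivAt_filt H.reference hb] with t ht hmem
  have hs := ht hmem
  have hmem' : t ∈ Icc 0 b := Ioo_subset_Icc_self hmem
  have hA := (h.hasDerivWithinAt_mat H hb hmem').hasDerivAt (Icc_mem_nhds hmem.1 hmem.2)
  have hAs := ((actCLM m).hasFDerivAt.comp_hasDerivAt t hA).clm_apply hs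
  have hV := (hs.inner ℝ hAs).const_mul (1 / 2 : ℝ)
  refine hV.congr_deriv ?_
  -- Symmetry of α merges the two product-rule terms that contain the rate of s.
  have hsymm : inner ℝ (C.filtRate P (x t) (ζ t) (θ t) t)
      (act (α (lower (x t)) t) (C.filt (x t) t)) =
      inner ℝ (C.filt (x t) t) (act (α (lower (x t)) t)
        (C.filtRate P (x t) (ζ t) (θ t) t)) := by
    rw [← inner_act_transpose, (H.controllable.symm _ t hmem'.1).eq]
  simp only [Function.comp, actCLM_apply, inner_add_right, Controller.energyRate]
  rw [hsymm]
  ring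

theorem monotoneOn_θ (H : Admissible P C α c lo hi af a₁ a₂)
    (h : IsClosedLoop P C T x ζ θ) (hb : b ∈ horizon T) : MonotoneOn θ (Icc 0 b) := by
  suffices AntitoneOn (-θ) (Icc 0 b) from fun u hu v hv huv => neg_le_neg_iff.1 (this hu hv huv)
  refine antitoneOn_of_ae_hasDerivAt_nonpos (h.θ_ac b hb).neg ?_
  filter_upwards [h.θ_law] with t ht hmem
  exact ⟨_, neg_nonpos.2 (Controller.θRate_nonneg H.design H.bounds (x t) hmem.1.le),
    (ht (mem_horizon hb (Ioo_subset_Icc_self hmem))).neg⟩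

theorem θ_nonneg (H : Admissible P C α c lo hi af a₁ a₂)
    (h : IsClosedLoop P C T x ζ θ) (ht : t ∈ horizon T) : 0 ≤ θ t :=
  h.θ_init.trans (h.monotoneOn_θ H ht ⟨le_rfl, ht.1⟩ ⟨ht.1, le_rfl⟩ ht.1)

theorem monotoneOn_ζ (H : Admissible P C α c lo hi af a₁ a₂)
    (h : IsClosedLoop P C T x ζ θ) (hb : b ∈ horizon T) : MonotoneOn ζ (Icc 0 b) := by
  suffices AntitoneOn (-ζ) (Icc 0 b) from fun u hu v hv huv => neg_le_neg_iff.1 (this hu hv huv)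
  refine antitoneOn_of_ae_hasDerivAt_nonpos (h.ζ_ac b hb).neg ?_
  filter_upwards [h.ζ_law] with t ht hmem
  have hm := mem_horizon hb (Ioo_subset_Icc_self hmem)
  exact ⟨_, neg_nonpos.2 (Controller.ζRate_nonneg H.design H.bounds (x t) (h.θ_nonneg H hm)
    hmem.1.le), (ht hm).neg⟩

theorem ζ_nonneg (H : Admissible P C α c lo hi af a₁ a₂)
    (h : IsClosedLoop P C T x ζ θ) (ht : t ∈ horizon T) : 0 ≤ ζ t :=
  h.ζ_init.trans (h.monotoneOn_ζ H ht ⟨le_rfl, ht.1⟩ ⟨ht.1, le_rfl⟩ ht.1)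

end IsClosedLoop

/-! ### The primitive G of the Nussbaum term -/

section NussbaumPrimitive

/-- `z + (hi H⁺(z) - lo H⁻(z)) / 2`, with `h` extended to the negative axis by a constant. -/
noncomputable def nussbaumPrimitive (h : ℝ → ℝ) (lo hi z : ℝ) : ℝ :=
  z + 1 / 2 * (hi * (∫ τ in (0 : ℝ)..z, max 0 (h (max 0 τ))) -
    lo * (∫ τ in (0 : ℝ)..z, max 0 (-h (max 0 τ))))

variable {h : ℝ → ℝ} {L lo hi : ℝ}

theorem nussbaumPrimitive_eq {z : ℝ} (hz : 0 ≤ z) : nussbaumPrimitive h lo hi z =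
    z + 1 / 2 * (hi * (∫ τ in (0 : ℝ)..z, max 0 (h τ)) -
      lo * (∫ τ in (0 : ℝ)..z, max 0 (-h τ))) := by
  have h1 : ∀ τ ∈ uIcc 0 z, max 0 τ = τ := fun τ hτ => by
    rw [uIcc_of_le hz] at hτ
    exact max_eq_right hτ.1
  rw [nussbaumPrimitive, intervalIntegral.integral_congr (g := fun τ => max 0 (h τ))
    (fun τ hτ => by simp only [h1 τ hτ]), intervalIntegral.integral_congr
    (f := fun τ => max 0 (-h (max 0 τ))) (g := fun τ => max 0 (-h τ))
    (fun τ hτ => by simp only [h1 τ hτ])]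

theorem IsNussbaumBL.continuous_extend (hh : IsNussbaumBL L h) :
    Continuous fun τ => h (max 0 τ) :=
  hh.contDiff.continuousOn.comp_continuous (by fun_prop) fun τ => le_max_left 0 τ

theorem hasDerivAt_nussbaumPrimitive (hh : Continuous fun τ => h (max 0 τ)) (lo hi z : ℝ) :
    HasDerivAt (nussbaumPrimitive h lo hi)
      (1 + 1 / 2 * (hi * max 0 (h (max 0 z)) - lo * max 0 (-h (max 0 z)))) z := by
  have h1 : Continuous fun τ => max 0 (h (max 0 τ)) := continuous_const.max hh
  have h2 : Continuous fun τ => max 0 (-h (max 0 τ)) := continuous_const.max hh.neg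
  exact (hasDerivAt_id z).add (((h1.integral_hasStrictDerivAt 0 z).hasDerivAt.const_mul hi).sub
    ((h2.integral_hasStrictDerivAt 0 z).hasDerivAt.const_mul lo) |>.const_mul (1 / 2))

/-- Being C¹ on the whole line, G is Lipschitz on compact intervals and preserves absolute
continuity. The extension of ħ to negative arguments is harmless, as ζ ≥ 0 along solutions. -/
theorem contDiff_nussbaumPrimitive (hh : Continuous fun τ => h (max 0 τ)) (lo hi : ℝ) :
    ContDiff ℝ 1 (nussbaumPrimitive h lo hi) := by
  have hd := hasDerivAt_nussbaumPrimitive hh lo hi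
  rw [contDiff_one_iff_deriv]
  refine ⟨fun z => (hd z).differentiableAt, ?_⟩
  rw [funext fun z => (hd z).deriv]
  exact continuous_const.add (continuous_const.mul
    ((continuous_const.mul (continuous_const.max hh)).sub
      (continuous_const.mul (continuous_const.max hh.neg))))

end NussbaumPrimitive

/-! ### The integrated Lyapunov inequality -/

namespace IsClosedLoop

variable {r m : ℕ} {P : Plant r m} {C : Controller r m} {α : (Fin r → Vec m) → ℝ → Mat m}
  {c lo hi af a₁ a₂ a L : ℝ} {T : EReal} {x : ℝ → Fin (r + 1) → Vec m} {ζ θ : ℝ → ℝ} {b t : ℝ}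

theorem intervalIntegrable_norm_filt_sq (hy : C.GoodReference) (h : IsClosedLoop P C T x ζ θ)
    (hb : b ∈ horizon T) :
    IntervalIntegrable (fun τ => ‖C.filt (x τ) τ‖ ^ 2) volume 0 b :=
  ((h.filt_ac hy hb).continuousOn.norm.pow 2).intervalIntegrable

theorem nussbaumPrimitive_ac (hh : Continuous fun τ => C.h (max 0 τ))
    (h : IsClosedLoop P C T x ζ θ) (hb : b ∈ horizon T) :
    AbsolutelyContinuousOnInterval (fun τ => nussbaumPrimitive C.h lo hi (ζ τ)) 0 b := by
  obtain ⟨K, hK⟩ := (h.ζ_ac b hb).exists_bound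
  obtain ⟨k, hk⟩ := (contDiff_nussbaumPrimitive hh lo hi).contDiffOn.exists_lipschitzOnWith
    (by decide) (convex_Icc (-K) K) isCompact_Icc
  exact absolutelyContinuous_comp_lipschitzOn hk (h.ζ_ac b hb) fun u hu => abs_le.1 (hK u hu)

/-- The full expression has a nonpositive derivative almost everywhere: a φ‖s‖ ≤ a θ̂' / σ₂ + aν
cancels against the -a θ̂' / σ₂ of the parameter error, and `ζRate_div_eq` converts the remaining θ̂
θ̂' / σ₂ + k‖s‖² into ζ' / σ₁, the source of the summand z in G. -/
theorem lyapunov_le (H : Admissible P C α c lo hi af a₁ a₂) (ha : IsGainBound C af a₁ a₂ a)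
    (hh : Continuous fun τ => C.h (max 0 τ))
    (h : IsClosedLoop P C T x ζ θ) (hb : b ∈ horizon T) :
    C.energy α (x b) b + 1 / (2 * C.σ₂) * ((θ b - a) * (θ b - a)) +
        C.k * (∫ τ in (0 : ℝ)..b, ‖C.filt (x τ) τ‖ ^ 2) - a * (∫ τ in (0 : ℝ)..b, C.ν τ) -
        1 / C.σ₁ * nussbaumPrimitive C.h lo hi (ζ b) ≤
      C.energy α (x 0) 0 + 1 / (2 * C.σ₂) * ((θ 0 - a) * (θ 0 - a)) -
        1 / C.σ₁ * nussbaumPrimitive C.h lo hi (ζ 0) := by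
  have hs := h.intervalIntegrable_norm_filt_sq H.reference hb
  have hν := H.design.ν_integrable b hb.1
  have h0 : (0 : ℝ) ∈ uIcc 0 b := left_mem_uIcc
  have hconst : AbsolutelyContinuousOnInterval (fun _ : ℝ => a) 0 b :=
    ((LipschitzWith.const a).lipschitzOnWith).absolutelyContinuousOnInterval
  have hθa := (h.θ_ac b hb).fun_sub hconst
  have hac := ((((h.energy_ac H hb).fun_add ((hθa.fun_mul hθa).const_mul (1 / (2 * C.σ₂)))).fun_add
    ((hs.absolutelyContinuousOnInterval_intervalIntegral h0).const_mul C.k)).fun_sub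
    ((hν.absolutelyContinuousOnInterval_intervalIntegral h0).const_mul a)).fun_sub
    ((h.nussbaumPrimitive_ac (lo := lo) (hi := hi) hh hb).const_mul (1 / C.σ₁))
  have key := le_of_ae_hasDerivAt_nonpos hb.1 hac (by
    filter_upwards [h.ae_hasDerivAt_energy H hb, h.ζ_law, h.θ_law, hs.ae_hasDerivAt_integral,
      hν.ae_hasDerivAt_integral] with t h1 h2 h3 h4 h5 hmem
    have hIcc : t ∈ Icc 0 b := Ioo_subset_Icc_self hmem
    have hu : t ∈ uIcc 0 b := by rwa [uIcc_of_le hb.1]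
    have hm := mem_horizon hb hIcc
    have hθ0 := h.θ_nonneg H hm
    have hd3 := (h3 hm).sub_const a
    have hG := (hasDerivAt_nussbaumPrimitive hh lo hi (ζ t)).comp t (h2 hm)
    have hd := ((((h1 hmem).fun_add ((hd3.fun_mul hd3).const_mul (1 / (2 * C.σ₂)))).fun_add
      ((h4 hu 0 h0).const_mul C.k)).fun_sub ((h5 hu 0 h0).const_mul a)).fun_sub
      (hG.const_mul (1 / C.σ₁))
    refine ⟨_, ?_, hd⟩
    rw [max_eq_right (h.ζ_nonneg H hm)]
    have e1 := energyRate_le H ha (x t) (ζ t) hθ0 hmem.1.le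
    have e2 := Controller.ζRate_div_eq H.design (x t) (θ t) t
    have e3 : C.θRate (x t) t / C.σ₂ = (C.core (x t) t * ‖C.filt (x t) t‖) ^ 2 /
        (C.core (x t) t * ‖C.filt (x t) t‖ + C.ν t) := by
      rw [Controller.θRate_eq, mul_div_cancel_left₀ _ H.design.σ₂_pos.ne']
    have e4 := le_sq_div_add (mul_nonneg (Controller.core_nonneg H.bounds (x t) t)
      (norm_nonneg (C.filt (x t) t))) (H.design.ν_nonneg t hmem.1.le)
    rw [← e3] at e4
    have ha0 : 0 ≤ a := H.growth.a₁_pos.le.trans ha.size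
    have e5 := mul_le_mul_of_nonneg_left e4 ha0
    have e6 : 1 / (2 * C.σ₂) * (C.θRate (x t) t * (θ t - a) + (θ t - a) * C.θRate (x t) t) =
        (θ t - a) * (C.θRate (x t) t / C.σ₂) := by
      have := H.design.σ₂_pos.ne'
      field_simp
      ring
    have e7 : ∀ q : ℝ, 1 / C.σ₁ * ((1 + q) * C.ζRate (x t) (θ t) t) =
        C.ζRate (x t) (θ t) t / C.σ₁ + q * (C.ζRate (x t) (θ t) t / C.σ₁) := fun q => by ring
    rw [e6, e7]
    linarith)
  simpa using key

end IsClosedLoop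

/-! ### Uniform bounds for the filtered error and the adaptation -/

section UniformBounds

variable {r m : ℕ} {P : Plant r m} {C : Controller r m} {α : (Fin r → Vec m) → ℝ → Mat m}
  {c lo hi af a₁ a₂ L : ℝ}

theorem norm_sum_smul_le_of_norm_le {lam : Fin r → ℝ} {v : Fin r → Vec m} {M : ℝ}
    (hv : ∀ i, ‖v i‖ ≤ M) : ‖∑ i, lam i • v i‖ ≤ (∑ i, |lam i|) * M := by
  rw [Finset.sum_mul]
  refine norm_sum_le_of_le _ fun _ _ => ?_
  rw [norm_smul, Real.norm_eq_abs]
  gcongr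
  exact hv _

theorem norm_filt_le {x : Fin (r + 1) → Vec m} {t M : ℝ} (h : ∀ i, ‖C.err x t i‖ ≤ M) :
    ‖C.filt x t‖ ≤ (∑ i, |C.lam i|) * M + M :=
  (norm_add_le _ _).trans (add_le_add (norm_sum_smul_le_of_norm_le fun _ => h _) (h _))

theorem norm_lower_le {x : Fin (r + 1) → Vec m} {R : ℝ} (hR : 0 ≤ R) (hx : ∀ i, ‖x i‖ ≤ R) :
    ‖lower x‖ ≤ R :=
  (pi_norm_le_iff_of_nonneg hR).2 fun i => hx i.castSucc

theorem exists_lyapunov_bound (H : Admissible P C α c lo hi af a₁ a₂)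
    (hh : IsNussbaumBL L C.h) {R : ℝ} (hR : 0 ≤ R) :
    ∃ a D : ℝ, 0 ≤ a ∧ 0 ≤ D ∧ ∀ (T : EReal) (x : ℝ → Fin (r + 1) → Vec m) (ζ θ : ℝ → ℝ),
      IsClosedLoop P C T x ζ θ → (∀ i, ‖x 0 i‖ ≤ R) → ζ 0 ≤ R → θ 0 ≤ R →
        ∀ t ∈ horizon T, C.energy α (x t) t + 1 / (2 * C.σ₂) * ((θ t - a) * (θ t - a)) +
          C.k * (∫ τ in (0 : ℝ)..t, ‖C.filt (x τ) τ‖ ^ 2) ≤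
            D + 1 / C.σ₁ * nussbaumPrimitive C.h lo hi (ζ t) := by
  obtain ⟨a, ha⟩ := Controller.exists_isGainBound H.reference H.growth.a₁_pos.le af a₂
  have ha0 : 0 ≤ a := H.growth.a₁_pos.le.trans ha.size
  have hσ₁ := H.design.σ₁_pos
  have hσ₂ := H.design.σ₂_pos
  have ha₁ := H.growth.a₁_pos
  have hhc := hh.continuous_extend
  obtain ⟨N, hN⟩ := H.design.ν_bounded
  obtain ⟨K, hK, hyK⟩ := H.reference.exists_bound
  obtain ⟨K₁, hK₁⟩ := H.bounds.φ₁_bounded R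
  obtain ⟨M, hM⟩ := (isCompact_Icc (a := 0) (b := R)).exists_bound_of_continuousOn
    (contDiff_nussbaumPrimitive hhc lo hi).continuous.continuousOn
  have hM0 : 0 ≤ M := (norm_nonneg _).trans (hM 0 ⟨le_rfl, hR⟩)
  have hN0 : 0 ≤ N := by simpa using hN 0 le_rfl
  -- The summands of D bound the initial energy, the initial parameter term, the integral of aν, and
  -- -G(ζ(0)) / σ₁.
  refine ⟨a, a₁ * |K₁| * ((∑ i, |C.lam i|) * (R + K) + (R + K)) ^ 2 +
    1 / (2 * C.σ₂) * (R + a) ^ 2 + a * N + 1 / C.σ₁ * M, ha0, by positivity,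
    fun T x ζ θ h hx hζ hθ t ht => ?_⟩
  have h1 := h.lyapunov_le H ha hhc ht
  have h2 : C.energy α (x 0) 0 ≤
      a₁ * |K₁| * ((∑ i, |C.lam i|) * (R + K) + (R + K)) ^ 2 := by
    refine (energy_upper H.growth (x 0) le_rfl).trans ?_
    gcongr
    · exact (hK₁ _ (norm_lower_le hR hx)).trans (le_abs_self _)
    · refine norm_filt_le fun i => (norm_sub_le _ _).trans ?_
      exact add_le_add (hx i) (hyK i (by omega) 0 le_rfl)
  have h3 : 1 / (2 * C.σ₂) * ((θ 0 - a) * (θ 0 - a)) ≤ 1 / (2 * C.σ₂) * (R + a) ^ 2 := by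
    have := h.θ_init
    gcongr
    nlinarith
  have h4 : a * (∫ τ in (0 : ℝ)..t, C.ν τ) ≤ a * N := mul_le_mul_of_nonneg_left (hN t ht.1) ha0
  have h5 : 1 / C.σ₁ * (-nussbaumPrimitive C.h lo hi (ζ 0)) ≤ 1 / C.σ₁ * M :=
    mul_le_mul_of_nonneg_left ((neg_le_abs _).trans (hM _ ⟨h.ζ_init, hζ⟩)) (by positivity)
  linarith

theorem exists_filt_adaptation_bound (H : Admissible P C α c lo hi af a₁ a₂)
    (hL : max (lo / hi) (hi / lo) < L) (hh : IsNussbaumBL L C.h) (R : ℝ) :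
    ∃ B : ℝ, 0 ≤ B ∧ ∀ (T : EReal) (x : ℝ → Fin (r + 1) → Vec m) (ζ θ : ℝ → ℝ),
      IsClosedLoop P C T x ζ θ → (∀ i, ‖x 0 i‖ ≤ R) → ζ 0 ≤ R → θ 0 ≤ R →
        ∀ t ∈ horizon T, ‖C.filt (x t) t‖ ≤ B ∧ ζ t ≤ B ∧ θ t ≤ B ∧
          C.k * (∫ τ in (0 : ℝ)..t, ‖C.filt (x τ) τ‖ ^ 2) ≤ B := by
  rcases lt_or_ge R 0 with hR | hR
  · exact ⟨0, le_rfl, fun T x ζ θ h _ hζ _ => absurd (h.ζ_init.trans hζ) (not_le.2 hR)⟩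
  obtain ⟨a, D, ha0, hD0, hlyap⟩ := exists_lyapunov_bound H hh hR
  have hσ₁ := H.design.σ₁_pos
  have hσ₂ := H.design.σ₂_pos
  have hk := H.design.k_pos
  have hc := H.controllable.c_pos
  -- Z is a barrier for ζ: there the right side of the Lyapunov inequality is negative. It depends
  -- on R alone, not on the solution.
  obtain ⟨Z, hRZ, hZ⟩ := hh.exists_lt H.controllable.same_sign hL R (-(C.σ₁ * D))
  have hZ0 : 0 ≤ Z := hR.trans hRZ.le
  rw [← nussbaumPrimitive_eq hZ0] at hZ
  obtain ⟨M, hM⟩ := (isCompact_Icc (a := 0) (b := Z)).exists_bound_of_continuousOn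
    (contDiff_nussbaumPrimitive hh.continuous_extend lo hi).continuous.continuousOn
  have hM0 : 0 ≤ M := (norm_nonneg _).trans (hM 0 ⟨le_rfl, hZ0⟩)
  obtain ⟨E, hE⟩ : ∃ E, E = D + 1 / C.σ₁ * M := ⟨_, rfl⟩
  have hE0 : 0 ≤ E := by rw [hE]; positivity
  have hEc : 0 ≤ 2 / c * E := by positivity
  have hEσ : 0 ≤ 2 * C.σ₂ * E := by positivity
  refine ⟨(1 + 2 / c * E) + Z + (a + 1 + 2 * C.σ₂ * E) + E, by positivity,
    fun T x ζ θ h hx hζ hθ t ht => ?_⟩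
  replace hlyap := hlyap T x ζ θ h hx hζ hθ
  have hpos : ∀ t ∈ horizon T, 0 ≤ C.energy α (x t) t ∧
      0 ≤ 1 / (2 * C.σ₂) * ((θ t - a) * (θ t - a)) ∧
      0 ≤ C.k * (∫ τ in (0 : ℝ)..t, ‖C.filt (x τ) τ‖ ^ 2) := fun t ht =>
    ⟨energy_nonneg H.controllable _ ht.1,
      mul_nonneg (by positivity) (mul_self_nonneg _),
      mul_nonneg hk.le (intervalIntegral.integral_nonneg ht.1 fun _ _ => sq_nonneg _)⟩
  have hζZ : ζ t < Z := by
    -- If ζ reached Z, it would take that value at some time τ, where a sum of nonnegative terms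
    -- would be negative.
    by_contra! hcon
    have hcont : ContinuousOn ζ (Icc 0 t) := by
      have := (h.ζ_ac t ht).continuousOn
      rwa [uIcc_of_le ht.1] at this
    obtain ⟨τ, hτ, hτZ⟩ := intermediate_value_Icc ht.1 hcont ⟨hζ.trans hRZ.le, hcon⟩
    have hτT := IsClosedLoop.mem_horizon ht hτ
    have h1 := hlyap τ hτT
    obtain ⟨h2, h3, h4⟩ := hpos τ hτT
    rw [hτZ] at h1
    have h5 := mul_lt_mul_of_pos_left hZ (one_div_pos.2 hσ₁)
    have h6 : 1 / C.σ₁ * (-(C.σ₁ * D)) = -D := by field_simp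
    linarith
  have hζ0 := h.ζ_nonneg H ht
  have h1 := hlyap t ht
  obtain ⟨h2, h3, h4⟩ := hpos t ht
  have h5 : 1 / C.σ₁ * nussbaumPrimitive C.h lo hi (ζ t) ≤ 1 / C.σ₁ * M :=
    mul_le_mul_of_nonneg_left ((le_abs_self _).trans (hM _ ⟨hζ0, hζZ.le⟩)) (by positivity)
  have hs2 : ‖C.filt (x t) t‖ ^ 2 ≤ 2 / c * E := by
    have h6 := energy_lower (C := C) H.controllable (x t) ht.1
    rw [div_mul_eq_mul_div, le_div_iff₀ hc]
    linarith
  have hθ2 : (θ t - a) * (θ t - a) ≤ 2 * C.σ₂ * E := by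
    have h6 : 1 / (2 * C.σ₂) * ((θ t - a) * (θ t - a)) ≤ E := by linarith
    rwa [one_div, inv_mul_le_iff₀ (by positivity)] at h6
  refine ⟨?_, ?_, ?_, ?_⟩
  -- From (y - 1)² ≥ 0 follows y ≤ 1 + y², which explains the summands 1 in the bound.
  · nlinarith [sq_nonneg (‖C.filt (x t) t‖ - 1)]
  · linarith
  · nlinarith [sq_nonneg (θ t - a - 1)]
  · linarith

end UniformBounds

/-! ### Bounds for all signals -/

section AllSignals

variable {r m : ℕ} {P : Plant r m} {C : Controller r m} {α : (Fin r → Vec m) → ℝ → Mat m}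
  {c lo hi af a₁ a₂ L : ℝ}

/-- The factor φ‖s‖ / (φ‖s‖ + ν) is at most 1, so the bound is free of ν, which need be neither
bounded nor bounded away from zero. -/
theorem norm_eta_le (hC : C.GoodDesign) (hφ : C.GoodBounds) (x : Fin (r + 1) → Vec m) {θ t : ℝ}
    (hθ : 0 ≤ θ) (ht : 0 ≤ t) :
    ‖C.eta x θ t‖ ≤ C.k * ‖C.filt x t‖ + θ * C.core x t := by
  have h1 := Controller.core_nonneg hφ x t
  have h2 := hC.ν_nonneg t ht
  have h3 : C.core x t * ‖C.filt x t‖ / (C.core x t * ‖C.filt x t‖ + C.ν t) ≤ 1 :=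
    div_le_one_of_le₀ (by linarith) (by positivity)
  have h4 : C.gain x θ t * ‖C.filt x t‖ = C.k * ‖C.filt x t‖ + θ * C.core x t *
      (C.core x t * ‖C.filt x t‖ / (C.core x t * ‖C.filt x t‖ + C.ν t)) := by
    rw [Controller.gain]
    ring
  rw [Controller.eta_eq, norm_smul, Real.norm_eq_abs,
    abs_of_nonneg (Controller.gain_nonneg hC hφ x hθ ht), h4]
  exact add_le_add_right (mul_le_of_le_one_right (by positivity) h3) _

theorem abs_ζRate_le (hC : C.GoodDesign) (x : Fin (r + 1) → Vec m) (θ t : ℝ) :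
    |C.ζRate x θ t| ≤ C.σ₁ * (‖C.filt x t‖ * ‖C.eta x θ t‖) := by
  rw [Controller.ζRate, abs_mul, abs_of_pos hC.σ₁_pos]
  exact mul_le_mul_of_nonneg_left (abs_real_inner_le_norm _ _) hC.σ₁_pos.le

theorem abs_θRate_le (hC : C.GoodDesign) (hφ : C.GoodBounds) (x : Fin (r + 1) → Vec m) {t : ℝ}
    (ht : 0 ≤ t) : |C.θRate x t| ≤ C.σ₂ * (C.core x t * ‖C.filt x t‖) := by
  rw [abs_of_nonneg (Controller.θRate_nonneg hC hφ x ht), Controller.θRate_eq]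
  exact mul_le_mul_of_nonneg_left (sq_div_add_le
    (mul_nonneg (Controller.core_nonneg hφ x t) (norm_nonneg _)) (hC.ν_nonneg t ht)) hC.σ₂_pos.le

theorem norm_actuator_le (hP : P.Faults) {t : ℝ} (ht : 0 ≤ t) (u : Vec m) :
    ‖P.actuator t u‖ ≤ ‖u‖ + ‖P.ε t‖ :=
  (norm_add_le _ _).trans (add_le_add_left (norm_act_diagonal_le (hP.ρ_mem t ht) u) _)

theorem IsNussbaumBL.exists_abs_bound {h : ℝ → ℝ} (hh : IsNussbaumBL L h) (B : ℝ) :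
    ∃ K : ℝ, 0 ≤ K ∧ ∀ z ∈ Icc 0 B, |h z| ≤ K := by
  obtain ⟨K, hK⟩ := isCompact_Icc.exists_bound_of_continuousOn
    (hh.contDiff.continuousOn.mono (Icc_subset_Ici_self : Icc 0 B ⊆ Ici 0))
  exact ⟨|K|, abs_nonneg K, fun z hz => (hK z hz).trans (le_abs_self K)⟩

/-- The states and the errors are bounded uniformly once the filtered error is. -/
theorem exists_state_err_bound (hy : C.GoodReference) (hC : C.GoodDesign) {R B : ℝ} (hR : 0 ≤ R)
    (hB : 0 ≤ B) :
    ∃ M : ℝ, 0 ≤ M ∧ ∀ (T : EReal) (x : ℝ → Fin (r + 1) → Vec m) (ζ θ : ℝ → ℝ),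
      IsClosedLoop P C T x ζ θ → (∀ i, ‖x 0 i‖ ≤ R) →
        (∀ t ∈ horizon T, ‖C.filt (x t) t‖ ≤ B) →
          ∀ t ∈ horizon T, ∀ i, ‖x t i‖ ≤ M ∧ ‖C.err (x t) t i‖ ≤ M := by
  obtain ⟨K, hK, hyK⟩ := hy.exists_bound
  obtain ⟨N, hN, hbd⟩ := exists_bound_of_hurwitz m C.lam hC.hurwitz
  refine ⟨N * (R + K + B) + K, by positivity, fun T x ζ θ h hx hs t ht i => ?_⟩
  have h1 : ‖C.err (x t) t i‖ ≤ N * (R + K + B) := by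
    refine hbd t (R + K + B) (fun τ => C.err (x τ) τ) ht.1 (by positivity)
      (fun i τ hτ => h.hasDerivWithinAt_err hy ht i hτ) (fun i => ?_) (fun τ hτ => ?_)
      i t ⟨ht.1, le_rfl⟩
    · have h2 : ‖C.err (x 0) 0 i‖ ≤ R + K :=
        (norm_sub_le _ _).trans (add_le_add (hx i) (hyK i (by omega) 0 le_rfl))
      linarith
    · have h2 : ‖C.filt (x τ) τ‖ ≤ B := hs τ (IsClosedLoop.mem_horizon ht hτ)
      rw [Controller.filt] at h2
      linarith
  have h2 := hyK i (by omega) t ht.1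
  have h3 : x t i = C.err (x t) t i + iteratedDerivWithin i C.y (Ici 0) t := by
    simp [Controller.err]
  refine ⟨?_, by linarith⟩
  rw [h3]
  exact (norm_add_le _ _).trans (add_le_add h1 h2)

/-- The core function is bounded where the states and the errors are. -/
theorem exists_core_bound (hφ : C.GoodBounds) {M : ℝ} (hM : 0 ≤ M) :
    ∃ K : ℝ, 0 ≤ K ∧ ∀ (x : Fin (r + 1) → Vec m) (t : ℝ),
      (∀ i, ‖x i‖ ≤ M ∧ ‖C.err x t i‖ ≤ M) → C.core x t ≤ K := by
  obtain ⟨K₁, hK₁⟩ := hφ.φ₁_bounded M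
  obtain ⟨K₂, hK₂⟩ := hφ.φ₂_bounded M
  obtain ⟨Kf, hKf⟩ := hφ.φf_bounded M
  refine ⟨|K₁| * ((∑ i, |C.lam i|) * M + |Kf| + 1) +
    1 / 2 * |K₂| * ((∑ i, |C.lam i|) * M + M), by positivity, fun x t hx => ?_⟩
  have hxM : ‖x‖ ≤ M := (pi_norm_le_iff_of_nonneg hM).2 fun i => (hx i).1
  have h1 := (hK₁ _ (norm_lower_le hM fun i => (hx i).1)).trans (le_abs_self K₁)
  have h2 := (hK₂ x hxM).trans (le_abs_self K₂)
  have h3 := (hKf x hxM).trans (le_abs_self Kf)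
  have h4 : ‖C.filt x t‖ ≤ (∑ i, |C.lam i|) * M + M := norm_filt_le fun i => (hx i).2
  have h5 : ‖C.Phi x t‖ ≤ (∑ i, |C.lam i|) * M :=
    norm_sum_smul_le_of_norm_le fun i => (hx i.succ).2
  have h6 := hφ.φf_nonneg x
  rw [Controller.core]
  gcongr

/-- The bounds on φ and on k∫‖s‖² are carried along for the convergence proof. -/
theorem exists_signals_bound (H : Admissible P C α c lo hi af a₁ a₂)
    (hL : max (lo / hi) (hi / lo) < L) (hh : IsNussbaumBL L C.h) (R : ℝ) :
    ∃ B : ℝ, 0 ≤ B ∧ ∀ (T : EReal) (x : ℝ → Fin (r + 1) → Vec m) (ζ θ : ℝ → ℝ),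
      IsClosedLoop P C T x ζ θ → (∀ i, ‖x 0 i‖ ≤ R) → ζ 0 ≤ R → θ 0 ≤ R →
        ∀ t ∈ horizon T, SignalsBoundedBy P C x ζ θ B t ∧ C.core (x t) t ≤ B ∧
          C.k * (∫ τ in (0 : ℝ)..t, ‖C.filt (x τ) τ‖ ^ 2) ≤ B := by
  rcases lt_or_ge R 0 with hR | hR
  · exact ⟨0, le_rfl, fun T x ζ θ h _ hζ _ => absurd (h.ζ_init.trans hζ) (not_le.2 hR)⟩
  obtain ⟨B, hB, hfilt⟩ := exists_filt_adaptation_bound H hL hh R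
  obtain ⟨M, hM, hstate⟩ := exists_state_err_bound (P := P) H.reference H.design hR hB
  obtain ⟨K, hK, hcore⟩ := exists_core_bound H.bounds hM
  obtain ⟨N, hN, hnuss⟩ := hh.exists_abs_bound B
  obtain ⟨ε, hε⟩ := H.faults.ε_bounded
  have hk := H.design.k_pos
  have hσ₁ := H.design.σ₁_pos
  have hσ₂ := H.design.σ₂_pos
  obtain ⟨η, hη⟩ : ∃ η, η = C.k * B + B * K := ⟨_, rfl⟩
  have hη0 : 0 ≤ η := by rw [hη]; positivity
  have hu0 : 0 ≤ N * η := by positivity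
  have hr1 : 0 ≤ C.σ₁ * (B * η) := by positivity
  have hr2 : 0 ≤ C.σ₂ * (K * B) := by positivity
  refine ⟨B + M + K + η + (N * η + |ε|) + C.σ₁ * (B * η) + C.σ₂ * (K * B), by positivity,
    fun T x ζ θ h hx hζ hθ t ht => ?_⟩
  obtain ⟨h1, h2, h3, h4⟩ := hfilt T x ζ θ h hx hζ hθ t ht
  have h5 := hstate T x ζ θ h hx (fun t ht => (hfilt T x ζ θ h hx hζ hθ t ht).1) t ht
  have h6 := hcore (x t) t h5
  have hζ0 := h.ζ_nonneg H ht
  have hθ0 := h.θ_nonneg H ht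
  have hφ0 := Controller.core_nonneg H.bounds (x t) t
  have hη1 : ‖C.eta (x t) (θ t) t‖ ≤ η := by
    refine (norm_eta_le H.design H.bounds (x t) hθ0 ht.1).trans ?_
    rw [hη]
    gcongr
  have hu1 : ‖C.control (x t) (ζ t) (θ t) t‖ ≤ N * η := by
    rw [Controller.control, norm_smul, Real.norm_eq_abs]
    gcongr
    exact hnuss _ ⟨hζ0, h2⟩
  have hua := norm_actuator_le H.faults ht.1 (C.control (x t) (ζ t) (θ t) t)
  have hε1 := (hε t ht.1).le.trans (le_abs_self ε)
  have hζr : |C.ζRate (x t) (θ t) t| ≤ C.σ₁ * (B * η) :=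
    (abs_ζRate_le H.design _ _ _).trans (by gcongr)
  have hθr : |C.θRate (x t) t| ≤ C.σ₂ * (K * B) :=
    (abs_θRate_le H.design H.bounds _ ht.1).trans (by gcongr)
  have hε0 := abs_nonneg ε
  rw [SignalsBoundedBy, abs_of_nonneg hζ0, abs_of_nonneg hθ0]
  refine ⟨⟨fun i => ?_, fun i => ?_, ?_, ?_, ?_, ?_, ?_, ?_, ?_, ?_⟩, ?_, ?_⟩
  · linarith [(h5 i).1]
  · linarith [(h5 i).2]
  all_goals linarith

end AllSignals

/-! ### Convergence of the tracking error -/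

section Convergence

/-- A nonnegative function with bounded integrals, and with increments bounded above by a multiple
of the elapsed time, vanishes at infinity. -/
theorem tendsto_zero_of_integral_bounded {V : ℝ → ℝ} {K M : ℝ} (hM : 0 ≤ M)
    (hc : ContinuousOn V (Ici 0)) (h0 : ∀ t : ℝ, 0 ≤ t → 0 ≤ V t)
    (hI : ∀ t : ℝ, 0 ≤ t → ∫ τ in (0 : ℝ)..t, V τ ≤ K)
    (hV : ∀ u t : ℝ, 0 ≤ u → u ≤ t → V t ≤ V u + M * (t - u)) : Tendsto V atTop (𝓝 0) := by
  have hint : ∀ u v : ℝ, 0 ≤ u → 0 ≤ v → IntervalIntegrable V volume u v := fun u v hu hv =>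
    (hc.mono fun τ hτ => (le_min hu hv).trans hτ.1).intervalIntegrable
  -- Cutting off at 0 makes J monotone on all of ℝ; being bounded, it converges, so its increments
  -- over windows of fixed length vanish.
  set J : ℝ → ℝ := fun t => ∫ τ in (0 : ℝ)..(max t 0), V τ with hJ
  have hadd : ∀ u t : ℝ, 0 ≤ u → u ≤ t → J t - J u = ∫ τ in u..t, V τ := fun u t hu hut => by
    simp only [hJ, max_eq_left hu, max_eq_left (hu.trans hut)]
    exact intervalIntegral.integral_interval_sub_left (hint 0 t le_rfl (hu.trans hut))
      (hint 0 u le_rfl hu)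
  have hmono : Monotone J := fun u t hut => by
    have h1 : max u 0 ≤ max t 0 := max_le_max_right 0 hut
    have h2 := hadd (max u 0) (max t 0) (le_max_right _ _) h1
    have h3 : 0 ≤ ∫ τ in (max u 0)..(max t 0), V τ :=
      intervalIntegral.integral_nonneg h1 fun τ hτ => h0 τ ((le_max_right _ _).trans hτ.1)
    simp only [hJ, max_eq_left (le_max_right _ (0 : ℝ))] at h2 ⊢
    linarith
  have hlim := tendsto_atTop_ciSup hmono ⟨K, by
    rintro _ ⟨t, rfl⟩
    exact hI _ (le_max_right _ _)⟩
  rw [Metric.tendsto_atTop]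
  intro ε hε
  set δ := ε / (2 * (M + 1)) with hδ
  have hδ0 : 0 < δ := by positivity
  have hMδ : M * δ ≤ ε / 2 := by
    have h1 : (M + 1) * δ = ε / 2 := by rw [hδ]; field_simp
    nlinarith
  have hdiff : Tendsto (fun t => J t - J (t - δ)) atTop (𝓝 0) := by
    simpa [sub_eq_add_neg] using hlim.sub (hlim.comp (tendsto_atTop_add_const_right atTop (-δ) tendsto_id))
  obtain ⟨N, hN⟩ := eventually_atTop.1 (hdiff.eventually_lt_const (u := δ * (ε / 2))
    (by positivity))
  refine ⟨max N δ, fun t ht => ?_⟩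
  have htN : N ≤ t := (le_max_left _ _).trans ht
  have htδ : 0 ≤ t - δ := sub_nonneg.2 ((le_max_right _ _).trans ht)
  have h1 := hN t htN
  rw [hadd (t - δ) t htδ (by linarith)] at h1
  -- A large value V t forces V ≥ V t - Mδ on the whole preceding window of length δ, hence a large
  -- integral there.
  have h2 : ∫ _τ in (t - δ)..t, (V t - M * δ) ≤ ∫ τ in (t - δ)..t, V τ := by
    refine intervalIntegral.integral_mono_on (by linarith) intervalIntegrable_const
      (hint _ _ htδ (by linarith)) fun τ hτ => ?_
    have h3 := hV τ t (htδ.trans hτ.1) hτ.2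
    have h4 : M * (t - τ) ≤ M * δ := mul_le_mul_of_nonneg_left (by linarith [hτ.1]) hM
    linarith
  rw [intervalIntegral.integral_const, smul_eq_mul, sub_sub_cancel] at h2
  have h3 : V t - M * δ < ε / 2 := lt_of_mul_lt_mul_left (h2.trans_lt h1) hδ0.le
  rw [Real.dist_eq, sub_zero, abs_of_nonneg (h0 t (by linarith))]
  linarith

variable {r m : ℕ} {P : Plant r m} {C : Controller r m} {α : (Fin r → Vec m) → ℝ → Mat m}
  {c lo hi af a₁ a₂ L : ℝ} {x : ℝ → Fin (r + 1) → Vec m} {ζ θ : ℝ → ℝ}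

theorem mem_horizon_top {t : ℝ} (ht : 0 ≤ t) : t ∈ horizon ⊤ := ⟨ht, EReal.coe_lt_top t⟩

/-- The argument runs on the energy rather than on s, because the hypotheses do not bound g and
hence do not bound the rate of s. The energy rate is bounded above by `energyRate_le`, and the
energy is at most a multiple of ‖s‖², whose integral is bounded. -/
theorem IsClosedLoop.tendsto_energy (H : Admissible P C α c lo hi af a₁ a₂)
    (hL : max (lo / hi) (hi / lo) < L) (hh : IsNussbaumBL L C.h)
    (h : IsClosedLoop P C ⊤ x ζ θ) :
    Tendsto (fun t => C.energy α (x t) t) atTop (𝓝 0) := by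
  have hx0 : ∀ i, ‖x 0 i‖ ≤ ‖x 0‖ := norm_le_pi_norm (x 0)
  have hζ0 := h.ζ_init
  have hθ0 := h.θ_init
  have hx00 := norm_nonneg (x 0)
  obtain ⟨B, hB, hbd⟩ := exists_signals_bound H hL hh (‖x 0‖ + ζ 0 + θ 0)
  replace hbd := fun t (ht : 0 ≤ t) => hbd ⊤ x ζ θ h (fun i => (hx0 i).trans (by linarith))
    (by linarith) (by linarith) t (mem_horizon_top ht)
  obtain ⟨a, ha⟩ := Controller.exists_isGainBound H.reference H.growth.a₁_pos.le af a₂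
  have ha0 : 0 ≤ a := H.growth.a₁_pos.le.trans ha.size
  have ha₁ := H.growth.a₁_pos
  have hk := H.design.k_pos
  have hσ₁ := H.design.σ₁_pos
  obtain ⟨N, hN, hnuss⟩ := hh.exists_abs_bound B
  obtain ⟨K₁, hK₁⟩ := H.bounds.φ₁_bounded B
  have hrate : ∀ t : ℝ, 0 ≤ t → C.energyRate P α (x t) (ζ t) (θ t) t ≤
      a * (B * B) + 1 / 2 * (|hi| * N + |lo| * N) * (B / C.σ₁) := by
    intro t ht
    obtain ⟨⟨-, -, hs, hζ, -, -, -, -, hζr, -⟩, hφ, -⟩ := hbd t ht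
    have hζt := h.ζ_nonneg H (mem_horizon_top ht)
    have hθt := h.θ_nonneg H (mem_horizon_top ht)
    have hφ0 := Controller.core_nonneg H.bounds (x t) t
    have hr0 := Controller.ζRate_nonneg H.design H.bounds (x t) hθt ht
    have hz := hnuss (ζ t) ⟨hζt, (le_abs_self _).trans hζ⟩
    have hp : |max 0 (C.h (ζ t))| ≤ N := by
      rw [abs_of_nonneg (le_max_left _ _)]
      exact max_le hN ((le_abs_self _).trans hz)
    have hm : |max 0 (-C.h (ζ t))| ≤ N := by
      rw [abs_of_nonneg (le_max_left _ _)]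
      exact max_le hN ((neg_le_abs _).trans hz)
    have h1 : hi * max 0 (C.h (ζ t)) - lo * max 0 (-C.h (ζ t)) ≤ |hi| * N + |lo| * N := by
      refine (le_abs_self _).trans ((abs_sub _ _).trans ?_)
      rw [abs_mul, abs_mul]
      gcongr
    refine (energyRate_le H ha (x t) (ζ t) hθt ht).trans ?_
    have h2 : C.ζRate (x t) (θ t) t ≤ B := (le_abs_self _).trans hζr
    gcongr
  have hcont : ContinuousOn (fun t => C.energy α (x t) t) (Ici 0) := by
    intro t ht
    have ht1 : t + 1 ∈ horizon ⊤ := mem_horizon_top (by linarith [mem_Ici.1 ht])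
    have h1 := (h.energy_ac H ht1).continuousOn
    rw [uIcc_of_le ht1.1] at h1
    refine (h1 t ⟨ht, by linarith⟩).mono_of_mem_nhdsWithin ?_
    filter_upwards [self_mem_nhdsWithin, nhdsWithin_le_nhds (Iio_mem_nhds (lt_add_one t))]
      with τ h2 h3 using ⟨h2, h3.le⟩
  refine tendsto_zero_of_integral_bounded (K := a₁ * |K₁| * (B / C.k))
    (M := a * (B * B) + 1 / 2 * (|hi| * N + |lo| * N) * (B / C.σ₁)) (by positivity) hcont
    (fun t ht => energy_nonneg H.controllable (x t) ht) (fun t ht => ?_) (fun u t hu hut => ?_)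
  · have hs := h.intervalIntegrable_norm_filt_sq H.reference (mem_horizon_top ht)
    have h1 : ∫ τ in (0 : ℝ)..t, C.energy α (x τ) τ ≤
        ∫ τ in (0 : ℝ)..t, a₁ * |K₁| * ‖C.filt (x τ) τ‖ ^ 2 := by
      refine intervalIntegral.integral_mono_on ht
        (ContinuousOn.intervalIntegrable (hcont.mono ?_)) (hs.const_mul _) fun τ hτ => ?_
      · rw [uIcc_of_le ht]
        exact Icc_subset_Ici_self
      · refine (energy_upper H.growth (x τ) hτ.1).trans ?_
        gcongr
        exact (hK₁ _ (norm_lower_le hB (hbd τ hτ.1).1.1)).trans (le_abs_self _)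
    rw [intervalIntegral.integral_const_mul] at h1
    refine h1.trans ?_
    gcongr
    rw [le_div_iff₀ hk, mul_comm]
    exact (hbd t ht).2.2
  · have ht : t ∈ horizon ⊤ := mem_horizon_top (hu.trans hut)
    set M := a * (B * B) + 1 / 2 * (|hi| * N + |lo| * N) * (B / C.σ₁) with hM
    have hlin : AbsolutelyContinuousOnInterval (fun τ : ℝ => M * τ) 0 t :=
      ((contDiff_const.mul contDiff_id).contDiffOn).absolutelyContinuousOnInterval
    -- Subtracting M τ turns the bound on the rate into monotonicity, and thus into a bound on
    -- increments.
    have h1 := antitoneOn_of_ae_hasDerivAt_nonpos ((h.energy_ac H ht).fun_sub hlin) (by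
      filter_upwards [h.ae_hasDerivAt_energy H ht] with τ hτ hmem
      refine ⟨_, ?_, (hτ hmem).fun_sub ((hasDerivAt_id τ).const_mul M)⟩
      have := hrate τ hmem.1.le
      linarith)
    have h2 := h1 ⟨hu, hut⟩ ⟨ht.1, le_rfl⟩ hut
    simp only at h2
    linarith

theorem IsClosedLoop.tendsto_filt (H : Admissible P C α c lo hi af a₁ a₂)
    (hL : max (lo / hi) (hi / lo) < L) (hh : IsNussbaumBL L C.h)
    (h : IsClosedLoop P C ⊤ x ζ θ) :
    Tendsto (fun t => C.filt (x t) t) atTop (𝓝 0) := by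
  have hc := H.controllable.c_pos
  have h1 : Tendsto (fun t => ‖C.filt (x t) t‖ ^ 2) atTop (𝓝 0) := by
    refine squeeze_zero' (Eventually.of_forall fun _ => sq_nonneg _) ?_
      (by simpa using (h.tendsto_energy H hL hh).const_mul (2 / c))
    filter_upwards [eventually_ge_atTop 0] with t ht
    have h2 := energy_lower (C := C) H.controllable (x t) ht
    rw [div_mul_eq_mul_div, le_div_iff₀ hc]
    linarith
  rw [tendsto_zero_iff_norm_tendsto_zero]
  simpa using h1.sqrt

theorem IsClosedLoop.tendsto_err (H : Admissible P C α c lo hi af a₁ a₂)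
    (hL : max (lo / hi) (hi / lo) < L) (hh : IsNussbaumBL L C.h)
    (h : IsClosedLoop P C ⊤ x ζ θ) (i : Fin (r + 1)) :
    Tendsto (fun t => C.err (x t) t i) atTop (𝓝 0) := by
  refine tendsto_zero_of_hurwitz (e := fun t => C.err (x t) t) C.lam H.design.hurwitz
    (fun j t ht => ?_) (h.tendsto_filt H hL hh) i
  have ht1 : t + 1 ∈ horizon ⊤ := mem_horizon_top (by linarith)
  refine (h.hasDerivWithinAt_err H.reference ht1 j
    ⟨ht, by linarith⟩).mono_of_mem_nhdsWithin ?_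
  filter_upwards [self_mem_nhdsWithin, nhdsWithin_le_nhds (Iio_mem_nhds (lt_add_one t))]
    with τ h2 h3 using ⟨h2, h3.le⟩

end Convergence

end FaultTolerant

theorem theorem2 (r m : ℕ) (P : FaultTolerant.Plant r m) (C : FaultTolerant.Controller r m)
    (hy : C.GoodReference) (hC : C.GoodDesign) (hφ : C.GoodBounds) (hP : P.Faults)
    (α : (Fin r → FaultTolerant.Vec m) → ℝ → FaultTolerant.Mat m) (c lo hi : ℝ)
    (hα : P.Controllable α c lo hi)
    (af a₁ a₂ : ℝ) (hgrowth : P.Growth C α af a₁ a₂)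
    (L : ℝ) (hL : max (lo / hi) (hi / lo) < L) (hh : FaultTolerant.IsNussbaumBL L C.h) :
    FaultTolerant.SignalsGloballyUniformlyBounded P C ∧
      ∀ (x : ℝ → Fin (r + 1) → FaultTolerant.Vec m) (ζ θ : ℝ → ℝ),
        FaultTolerant.IsClosedLoop P C ⊤ x ζ θ →
          Tendsto (fun t => C.err (x t) t 0) atTop (𝓝 0) := by
  have H : FaultTolerant.Admissible P C α c lo hi af a₁ a₂ := ⟨hy, hC, hφ, hP, hα, hgrowth⟩
  refine ⟨fun R => ?_, fun x ζ θ h => h.tendsto_err H hL hh 0⟩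
  obtain ⟨B, -, hB⟩ := FaultTolerant.exists_signals_bound H hL hh R
  exact ⟨B, fun T x ζ θ h hx hζ hθ t ht => (hB T x ζ θ h hx hζ hθ t ht).1⟩
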